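/- Let $k$ be a field, $H$ a Hopf algebra over $k$, and $A$ a nonzero finite-dimensional right $H$-comodule algebra, i.e. a $k$-algebra with a right $H$-comodule structure $\rho_A:A\to A\otimes H$ that is a homomorphism of unital algebras. Assume that $A$ is $H$-simple: it has no nonzero proper two-sided ideal $I$ with $\rho_A(I)\subseteq I\otimes H$. Assume also that $H$ is weakly finite: for every $n>0$ and all $X,Y\in \mathrm{Mat}_n(H)$, $XY=1$ implies $YX=1$. Let $\mathcal M_A^H$ (resp. ${}_A\mathcal M^H$) be the category of right (resp. left) $A$-modules $M$ equipped with a right $H$-comodule structure $\rho_M:M\to M\otimes H$ such that $\rho_M(ma)=\rho_M(m)\rho_A(a)$ (resp. $\rho_M(am)=\rho_A(a)\rho_M(m)$) for all $m\in M$, $a\in A$. Here $M\otimes H$ is a right (resp. left) $A\otimes H$-module, with $A$ acting on $M$ and $H$ acting on itself by multiplication. Let $\operatorname{Max}A$ be the set of maximal two-sided ideals of $A$. Then: (i) $A$ is Frobenius, i.e. $A\cong A^*=\operatorname{Hom}_k(A,k)$ as right $A$-modules, where $(\xi a)(b)=\xi(ab)$ for $\xi\in A^*$ and $a,b\in A$;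 (ii) all objects of both $\mathcal M_A^H$ and ${}_A\mathcal M^H$ are projective $A$-modules; (iii) $M\in\mathcal M_A^H$ (resp. $M\in{}_A\mathcal M^H$) is a free $A$-module if and only if $M/MQ$ (resp. $M/QM$) is a free $A/Q$-module for at least one $Q\in\operatorname{Max}A$. -/

import Mathlib

open scoped TensorProduct

noncomputable section

/-- A right comodule over a `k`-coalgebra `H`: a `k`-linear coaction `ρ : M → M ⊗ H` which is
coassociative, `(ρ ⊗ id) ∘ ρ = (id ⊗ Δ) ∘ ρ`, and counital, `(id ⊗ ε) ∘ ρ = id`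
(with `M ⊗ k` identified with `M`). -/
class RightComodule (k H M : Type*) [Field k] [AddCommGroup H] [Module k H] [Coalgebra k H]
    [AddCommGroup M] [Module k M] where
  coact (k H M) : M →ₗ[k] M ⊗[k] H
  coassoc : (TensorProduct.assoc k M H H).toLinearMap ∘ₗ coact.rTensor H ∘ₗ coact =
    (Coalgebra.comul (R := k) (A := H)).lTensor M ∘ₗ coact
  counital : (TensorProduct.rid k M).toLinearMap ∘ₗ
    (Coalgebra.counit (R := k) (A := H)).lTensor M ∘ₗ coact = LinearMap.id

/-- A right `H`-comodule algebra: an algebra `A` with a right `H`-comodule structure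
`ρ_A : A → A ⊗ H` which is a homomorphism of unital algebras. -/
class RightComoduleAlgebra (k H A : Type*) [Field k] [Ring H] [Bialgebra k H]
    [Ring A] [Algebra k A] extends RightComodule k H A where
  coact_one : coact (1 : A) = 1
  coact_mul : ∀ a b : A, coact (a * b) = coact a * coact b

/-- The action of `A ⊗ H` on the right of `M ⊗ H`, for a right `A`-module `M`
(a module over `Aᵐᵒᵖ`): `(m ⊗ g) (a ⊗ h) = m a ⊗ g h`. -/
def tensorRightAction (k H A M : Type*) [Field k] [Ring H] [Algebra k H] [Ring A] [Algebra k A]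
    [AddCommGroup M] [Module k M] [Module Aᵐᵒᵖ M] [IsScalarTower k Aᵐᵒᵖ M] :
    M ⊗[k] H →ₗ[k] A ⊗[k] H →ₗ[k] M ⊗[k] H :=
  TensorProduct.map₂
    ((Algebra.lsmul k k M).toLinearMap ∘ₗ (MulOpposite.opLinearEquiv k (M := A)).toLinearMap).flip
    (LinearMap.mul k H)

/-- The action of `A ⊗ H` on the left of `M ⊗ H`, for a left `A`-module `M`:
`(a ⊗ h) (m ⊗ g) = a m ⊗ h g`. -/
def tensorLeftAction (k H A M : Type*) [Field k] [Ring H] [Algebra k H] [Ring A] [Algebra k A]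
    [AddCommGroup M] [Module k M] [Module A M] [IsScalarTower k A M] :
    A ⊗[k] H →ₗ[k] M ⊗[k] H →ₗ[k] M ⊗[k] H :=
  TensorProduct.map₂ (Algebra.lsmul k k M).toLinearMap (LinearMap.mul k H)

theorem tensorRightAction_tmul {k H A M : Type*} [Field k] [Ring H] [Algebra k H] [Ring A]
    [Algebra k A] [AddCommGroup M] [Module k M] [Module Aᵐᵒᵖ M] [IsScalarTower k Aᵐᵒᵖ M]
    (m : M) (g : H) (a : A) (h : H) :
    tensorRightAction k H A M (m ⊗ₜ g) (a ⊗ₜ h) = (MulOpposite.op a • m) ⊗ₜ (g * h) := rfl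

theorem tensorLeftAction_tmul {k H A M : Type*} [Field k] [Ring H] [Algebra k H] [Ring A]
    [Algebra k A] [AddCommGroup M] [Module k M] [Module A M] [IsScalarTower k A M]
    (a : A) (h : H) (m : M) (g : H) :
    tensorLeftAction k H A M (a ⊗ₜ h) (m ⊗ₜ g) = (a • m) ⊗ₜ (h * g) := rfl

/-- An object of the category `M_A^H`: a right `A`-module `M` with a right `H`-comodule structure
satisfying `ρ_M (m a) = ρ_M (m) ρ_A (a)`. -/
class RightHopfModule (k H A M : Type*) [Field k] [Ring H] [Bialgebra k H]
    [Ring A] [Algebra k A] [RightComoduleAlgebra k H A]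
    [AddCommGroup M] [Module k M] [Module Aᵐᵒᵖ M] [IsScalarTower k Aᵐᵒᵖ M]
    extends RightComodule k H M where
  coact_smul : ∀ (m : M) (a : A), coact (MulOpposite.op a • m) =
    tensorRightAction k H A M (coact m) (RightComodule.coact k H A a)

/-- An object of the category `_A M^H`: a left `A`-module `M` with a right `H`-comodule structure
satisfying `ρ_M (a m) = ρ_A (a) ρ_M (m)`. -/
class LeftHopfModule (k H A M : Type*) [Field k] [Ring H] [Bialgebra k H]
    [Ring A] [Algebra k A] [RightComoduleAlgebra k H A]
    [AddCommGroup M] [Module k M] [Module A M] [IsScalarTower k A M]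
    extends RightComodule k H M where
  coact_smul : ∀ (a : A) (m : M), coact (a • m) =
    tensorLeftAction k H A M (RightComodule.coact k H A a) (coact m)

/-- A two-sided ideal `I` of `A` is `H`-costable if `ρ_A (I) ⊆ I ⊗ H`, where `I ⊗ H` is
identified with its image in `A ⊗ H`. -/
def IsCostable (k H : Type*) {A : Type*} [Field k] [Ring H] [Bialgebra k H]
    [Ring A] [Algebra k A] [RightComoduleAlgebra k H A] (I : TwoSidedIdeal A) : Prop :=
  ∀ a ∈ I, RightComodule.coact k H A a ∈
    LinearMap.range ((I.asIdeal.restrictScalars k).subtype.rTensor H)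

/-- `A` is `H`-simple if it is nonzero and has no nonzero proper `H`-costable two-sided ideals. -/
def IsHSimple (k H A : Type*) [Field k] [Ring H] [Bialgebra k H]
    [Ring A] [Algebra k A] [RightComoduleAlgebra k H A] : Prop :=
  Nontrivial A ∧ ∀ I : TwoSidedIdeal A, IsCostable k H I → I = ⊥ ∨ I = ⊤

/-- A finite-dimensional algebra `A` is Frobenius if `A ≅ A^*` as right `A`-modules, where
`(ξ a) (b) = ξ (a b)` for `ξ` in the `k`-linear dual `A^*`. -/
def IsFrobeniusAlgebra (k A : Type*) [Field k] [Ring A] [Algebra k A] : Prop :=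
  FiniteDimensional k A ∧
    ∃ e : A ≃ₗ[k] Module.Dual k A, ∀ x a b : A, e (x * a) b = e x (a * b)

/-- For a right `A`-module `M` and a two-sided ideal `Q`, the right `A/Q`-module `M/MQ` is free.
Right modules over `A/Q` are left modules over `(A/Q)ᵐᵒᵖ`, which is the quotient of `Aᵐᵒᵖ` by
the ideal `{op q | q ∈ Q}`. -/
def RightReductionFree {A : Type*} [Ring A] (M : Type*) [AddCommGroup M] [Module Aᵐᵒᵖ M]
    (Q : TwoSidedIdeal A) : Prop :=
  Module.Free (Aᵐᵒᵖ ⧸ Q.op.asIdeal) (M ⧸ (Q.op.asIdeal • ⊤ : Submodule Aᵐᵒᵖ M))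

/-- For a left `A`-module `M` and a two-sided ideal `Q`, the left `A/Q`-module `M/QM` is free. -/
def LeftReductionFree {A : Type*} [Ring A] (M : Type*) [AddCommGroup M] [Module A M]
    (Q : TwoSidedIdeal A) : Prop :=
  Module.Free (A ⧸ Q.asIdeal) (M ⧸ (Q.asIdeal • ⊤ : Submodule A M))

end

/-! For a finite-dimensional `M` and a maximal ideal `P`, call `dim (M/MP) / dim (A/P)` the rank of
`M` at `P`. Modules over the simple algebra `A/P` are classified by dimension. Hence, by the Chinese
remainder theorem and Nakayama, `A^n` maps onto `M^l` as soon as `n` bounds every rank of `M^l`.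

The heart is `IsGeneratingCoaction.hasFreePower`: a finite-dimensional right module with a coaction
has a free power. Take `P` of maximal rank and set `l = dim (A/P)`, `n = dim (M/MP)`, so that there
is a surjection `f : A^n → M^l` whose two sides have equal dimension modulo `P`. The coaction turns
`f` into a surjection `(A/P)^n ⊗ H → (M^l/M^l P) ⊗ H` of free `H`-modules of the same finite rank,
which is injective because `H` is weakly finite. The coordinates `a` of an element of `ker f`
therefore satisfy `ρ(a) ∈ P ⊗ H`, and such `a` vanish by `H`-simplicity. So `M^l ≅ A^n`.

The antipode makes the dual of a finite-dimensional left Hopf module such a right module. For `A^*`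
a dimension count turns the free power into `A^* ≅ A`, which is the Frobenius property; for other
left Hopf modules the free power is transported back through this duality.

An arbitrary Hopf module is exhausted by finitely generated Hopf submodules, which have free powers
and so are injective over the self-injective algebra `A`. Hence the whole module is injective, and
injective modules over a Frobenius algebra are projective. For freeness, a finitely generated `M`
has the same rank at every `P`, and this rank is an integer once `M/MQ` is free; a module that is
not finitely generated satisfies `dim (M/MP) = dim M` for all `P` and is always free
(`IsFreePowerFamily.free_of_not_finite`). -/

namespace TwoSidedIdeal

/-! ### Maximal two-sided ideals. -/

theorem exists_coatom_ge {R : Type*} [Ring R] [IsNoetherianRing R] {I : TwoSidedIdeal R}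
    (hI : I ≠ ⊤) : ∃ P : TwoSidedIdeal R, IsCoatom P ∧ I ≤ P := by
  have hw : WellFounded ((· > ·) : TwoSidedIdeal R → TwoSidedIdeal R → Prop) :=
    Subrelation.wf (r := InvImage (· > ·) (asIdeal (R := R)))
      (fun {a b} (h : b < a) => show b.asIdeal < a.asIdeal from
        lt_of_le_of_ne (asIdeal.monotone h.le) fun e => h.ne (by
          ext x; rw [← mem_asIdeal, e, mem_asIdeal]))
      (InvImage.wf _ wellFounded_gt)
  have := isCoatomic_of_orderTop_gt_wellFounded hw
  exact (eq_top_or_exists_le_coatom I).resolve_left hI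

theorem isSimpleRing_quotient {R : Type*} [Ring R] {P : TwoSidedIdeal R} (hP : IsCoatom P) :
    IsSimpleRing (R ⧸ P.asIdeal) := by
  have hne : Nontrivial (R ⧸ P.asIdeal) := by
    refine Ideal.Quotient.nontrivial_iff.2 fun h => hP.1 ?_
    rw [← one_mem_iff, ← mem_asIdeal, h]; trivial
  refine ⟨⟨fun I => ?_⟩⟩
  have hle : P ≤ I.comap (Ideal.Quotient.mk P.asIdeal) := fun x hx => by
    rw [mem_comap, Ideal.Quotient.eq_zero_iff_mem.2 (mem_asIdeal.2 hx)]
    exact I.zero_mem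
  rcases hP.le_iff.1 hle with h | h
  · right
    rw [← one_mem_iff]
    have : (1 : R) ∈ I.comap (Ideal.Quotient.mk P.asIdeal) := h ▸ trivial
    simpa [mem_comap] using this
  · left
    rw [eq_bot_iff]
    intro x hx
    obtain ⟨r, rfl⟩ := Ideal.Quotient.mk_surjective x
    have : r ∈ I.comap (Ideal.Quotient.mk P.asIdeal) := by rwa [mem_comap]
    rw [h] at this
    rw [mem_bot]
    exact Ideal.Quotient.eq_zero_iff_mem.2 (mem_asIdeal.2 this)

theorem exists_one_sub_mem_of_ne {R : Type*} [Ring R] {P P' : TwoSidedIdeal R} (hP : IsCoatom P)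
    (hP' : IsCoatom P') (h : P ≠ P') : ∃ x ∈ P', 1 - x ∈ P := by
  have h1 : (1 : R) ∈ P ⊔ P' := by
    rw [IsCoatom.sup_eq_top_of_ne hP hP' h]; trivial
  obtain ⟨y, hy, z, hz, e⟩ := mem_sup.1 h1
  exact ⟨z, hz, by rwa [← e, add_sub_cancel_right]⟩

end TwoSidedIdeal

/-! ### Modules over a finite-dimensional simple algebra. -/

section SimpleRing

universe u v w

theorem lift_rank_finsupp_mul {k : Type*} [Field k] {S : Type u} [AddCommGroup S] [Module k S]
    [Module.Finite k S] {V : Type v} [AddCommGroup V] [Module k V] {ι : Type w}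
    (e : V ≃ₗ[k] ι →₀ S) :
    Cardinal.lift.{max u w} (Module.rank k V) =
      Cardinal.lift.{max u v} (Cardinal.mk ι) * (Module.finrank k S : ℕ) := by
  have := e.lift_rank_eq
  rw [rank_finsupp, ← Module.finrank_eq_rank k S] at this
  simpa [-Module.finrank_eq_rank] using this

variable {k : Type*} {B : Type u} [Field k] [Ring B] [Algebra k B] [FiniteDimensional k B] [IsSimpleRing B]

/-- Isotypicity compares simple submodules of a single module, so it is applied to `V × S`, which
contains a copy of `S`. -/
theorem IsSimpleRing.isIsotypicOfType (S : Type*) [AddCommGroup S] [Module B S] [IsArtinianRing B]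
    [IsSimpleModule B S] (V : Type*) [AddCommGroup V] [Module B V] : IsIsotypicOfType B V S := by
  have h := IsSimpleRing.isIsotypic B (V × S)
  have e : S ≃ₗ[B] LinearMap.range (LinearMap.inr B V S) :=
    LinearEquiv.ofInjective _ LinearMap.inr_injective
  have : IsSimpleModule B (LinearMap.range (LinearMap.inr B V S)) := IsSimpleModule.congr e.symm
  exact ((h _).of_injective (LinearMap.inl B V S) LinearMap.inl_injective).of_linearEquiv_type e.symm

/-- Modules over a finite-dimensional simple algebra are compared by their dimensions. -/
theorem IsSimpleRing.exists_linearMap_of_rank_le {V : Type v} {W : Type w} [AddCommGroup V]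
    [Module k V] [Module B V] [IsScalarTower k B V] [AddCommGroup W] [Module k W] [Module B W]
    [IsScalarTower k B W]
    (h : Cardinal.lift.{w} (Module.rank k V) ≤ Cardinal.lift.{v} (Module.rank k W)) :
    ∃ g : W →ₗ[B] V, Function.Surjective g ∧
      (Cardinal.lift.{w} (Module.rank k V) = Cardinal.lift.{v} (Module.rank k W) →
        Function.Injective g) := by
  have : IsArtinianRing B := IsArtinianRing.of_finite k B
  obtain ⟨S, hS⟩ := IsSemisimpleModule.exists_simple_submodule B B
  have : Module.Finite k S := inferInstanceAs (Module.Finite k (S.restrictScalars k))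
  have : Nontrivial S := IsSimpleModule.nontrivial B S
  obtain ⟨ι, ⟨eV⟩⟩ := (IsSimpleRing.isIsotypicOfType (B := B) S V).linearEquiv_finsupp
  obtain ⟨κ, ⟨eW⟩⟩ := (IsSimpleRing.isIsotypicOfType (B := B) S W).linearEquiv_finsupp
  have hn : Module.finrank k S ≠ 0 := (Module.finrank_pos (R := k) (M := S)).ne'
  have hV := lift_rank_finsupp_mul (eV.restrictScalars k)
  have hW := lift_rank_finsupp_mul (eW.restrictScalars k)
  have hV' := congrArg Cardinal.lift.{w} hV
  have hW' := congrArg Cardinal.lift.{v} hW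
  simp only [Cardinal.lift_lift, Cardinal.lift_mul, Cardinal.lift_natCast] at hV' hW'
  rw [Cardinal.lift_umax.{v, max u w}] at hV'
  rw [Cardinal.lift_umax.{w, max u v}] at hW'
  have h' := Cardinal.lift_le.{u}.2 h
  simp only [Cardinal.lift_lift] at h'
  -- Equality is treated apart: for infinite ranks, an embedding of index sets need not be a
  -- bijection even when the cardinals agree.
  by_cases heq : Cardinal.lift.{w} (Module.rank k V) = Cardinal.lift.{v} (Module.rank k W)
  · have h'' := congrArg Cardinal.lift.{u} heq
    simp only [Cardinal.lift_lift] at h''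
    rw [hV', hW', Cardinal.mul_natCast_inj hn] at h''
    have : Cardinal.lift.{w} (Cardinal.mk ι) = Cardinal.lift.{v} (Cardinal.mk κ) :=
      Cardinal.lift_injective.{u} (by simpa only [Cardinal.lift_lift] using h'')
    obtain ⟨j⟩ := Cardinal.lift_mk_eq'.1 this
    let g := (eW.trans (Finsupp.domLCongr j.symm)).trans eV.symm
    exact ⟨g.toLinearMap, g.surjective, fun _ => g.injective⟩
  · rw [hV', hW', Cardinal.mul_natCast_le_mul_natCast hn] at h'
    have : Cardinal.lift.{w} (Cardinal.mk ι) ≤ Cardinal.lift.{v} (Cardinal.mk κ) :=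
      Cardinal.lift_le.{u}.1 (by simpa only [Cardinal.lift_lift] using h')
    obtain ⟨j⟩ := Cardinal.lift_mk_le'.1 this
    let c : (κ →₀ S) →ₗ[B] (ι →₀ S) := Finsupp.lcomapDomain j j.injective
    have hc : Function.Surjective c := fun x =>
      ⟨x.embDomain j, Finsupp.ext fun i => by
        simp [c, Finsupp.lcomapDomain]⟩
    exact ⟨eV.symm.toLinearMap ∘ₗ c ∘ₗ eW.toLinearMap,
      eV.symm.surjective.comp (hc.comp eW.surjective), fun e => absurd e heq⟩

end SimpleRing

/-! ### Nakayama's lemma and the Chinese remainder theorem for maximal two-sided ideals. -/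

section Nakayama

/-- A simple module over a finite-dimensional algebra is killed by a maximal two-sided ideal. -/
theorem IsSimpleModule.exists_isCoatom_smul_eq_zero (k : Type*) {R : Type*} [Field k] [Ring R]
    [Algebra k R] [FiniteDimensional k R] (S : Type*) [AddCommGroup S] [Module R S]
    [IsSimpleModule R S] :
    ∃ P : TwoSidedIdeal R, IsCoatom P ∧ ∀ r ∈ P, ∀ s : S, r • s = 0 := by
  have : IsArtinianRing R := IsArtinianRing.of_finite k R
  let _ : Module k S := Module.compHom S (algebraMap k R)
  have : IsScalarTower k R S := ⟨fun c r s => by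
    rw [Algebra.smul_def, mul_smul]; rfl⟩
  have : Module.Finite k S := Module.Finite.trans R S
  have : Nontrivial S := IsSimpleModule.nontrivial R S
  let b := Module.finBasis k S
  -- Since `k` acts centrally, `r` kills `S` once it kills a `k`-basis; so `R / ann S` embeds in a
  -- finite power of `S`.
  let φ : R →ₗ[R] (Fin (Module.finrank k S) → S) :=
    LinearMap.pi fun i => LinearMap.toSpanSingleton R S (b i)
  have hφ : ∀ r : R, φ r = 0 → ∀ s : S, r • s = 0 := fun r hr s => by
    rw [← b.sum_repr s, Finset.smul_sum]
    refine Finset.sum_eq_zero fun i _ => ?_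
    rw [smul_comm, show r • b i = 0 from congrFun hr i, smul_zero]
  obtain ⟨P, hP, hNP⟩ := TwoSidedIdeal.exists_coatom_ge
    (I := (Module.annihilator R S).toTwoSided) (by
      rw [Ne, ← TwoSidedIdeal.one_mem_iff, Ideal.mem_toTwoSided, Module.mem_annihilator]
      intro h
      obtain ⟨s, hs⟩ := exists_ne (0 : S)
      exact hs (by simpa using h s))
  refine ⟨P, hP, ?_⟩
  have := TwoSidedIdeal.isSimpleRing_quotient hP
  let q : (R ⧸ LinearMap.ker φ) →ₗ[R] (R ⧸ P.asIdeal) :=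
    Submodule.mapQ _ _ LinearMap.id fun r hr => hNP (by
      rw [Ideal.mem_toTwoSided, Module.mem_annihilator]
      exact hφ r hr)
  -- The power of `S` is semisimple, so the nonzero map `R / ann S → R/P` extends to it. Some
  -- component `S → R/P` is nonzero, hence injective, and `P` kills `R/P`.
  obtain ⟨h, hh⟩ := IsSemisimpleModule.extension_property
    ((LinearMap.ker φ).liftQ φ le_rfl) (LinearMap.ker_eq_bot.1 (Submodule.ker_liftQ_eq_bot _ _ _ le_rfl)) q
  obtain ⟨i, hi⟩ : ∃ i, h ∘ₗ LinearMap.single R (fun _ => S) i ≠ 0 := by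
    by_contra! h0
    have h1 : h = 0 := LinearMap.pi_ext' fun i => by rw [h0 i, LinearMap.zero_comp]
    have h2 : q (Submodule.Quotient.mk 1) = 0 := by rw [← hh, h1]; rfl
    exact one_ne_zero (α := R ⧸ P.asIdeal) h2
  have hinj := (LinearMap.injective_or_eq_zero (h ∘ₗ LinearMap.single R (fun _ => S) i)).resolve_right hi
  intro r hr s
  apply hinj
  rw [map_smul, map_zero]
  obtain ⟨y, hy⟩ := Ideal.Quotient.mk_surjective ((h ∘ₗ LinearMap.single R (fun _ => S) i) s)
  rw [← hy]
  exact Ideal.Quotient.eq_zero_iff_mem.2 (P.mul_mem_right _ _ hr)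

/-- Some finite product of maximal two-sided ideals of a finite-dimensional algebra is zero. -/
theorem exists_list_isCoatom_foldr_eq_bot (k R : Type*) [Field k] [Ring R] [Algebra k R]
    [FiniteDimensional k R] :
    ∃ l : List (TwoSidedIdeal R), (∀ P ∈ l, IsCoatom P) ∧
      l.foldr (fun P (X : Ideal R) => P.asIdeal • X) ⊤ = ⊥ := by
  have : IsArtinianRing R := IsArtinianRing.of_finite k R
  obtain ⟨X, ⟨l, hl, rfl⟩, hmin⟩ := (wellFounded_lt (α := Ideal R)).has_min
    {X | ∃ l : List (TwoSidedIdeal R), (∀ P ∈ l, IsCoatom P) ∧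
      l.foldr (fun P (X : Ideal R) => P.asIdeal • X) ⊤ = X} ⟨⊤, [], by simp⟩
  refine ⟨l, hl, ?_⟩
  set X := l.foldr (fun P (X : Ideal R) => P.asIdeal • X) ⊤ with hX
  by_contra hne
  have : Nontrivial X := Submodule.nontrivial_iff_ne_bot.2 hne
  -- A minimal nonzero product `X` has a simple quotient `X/Y`; a maximal ideal `P` killing it gives
  -- the smaller product `P X ⊆ Y`.
  obtain ⟨Y, hY, -⟩ := (eq_top_or_exists_le_coatom (⊥ : Submodule R X)).resolve_left bot_ne_top
  have : IsSimpleModule R (X ⧸ Y) := (isSimpleModule_iff_isCoatom (R := R) (M := X) (m := Y)).2 hY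
  obtain ⟨P, hP, hPS⟩ := IsSimpleModule.exists_isCoatom_smul_eq_zero k (R := R) (X ⧸ Y)
  refine hmin (P.asIdeal • X) ⟨P :: l, by simpa [hP] using hl, rfl⟩ ?_
  refine lt_of_le_of_lt (b := Y.map X.subtype) ?_ ?_
  · refine Submodule.smul_le.2 fun r hr x hx => ?_
    refine ⟨r • ⟨x, hx⟩, ?_, rfl⟩
    rw [SetLike.mem_coe, ← Submodule.Quotient.mk_eq_zero]
    exact hPS r hr (Submodule.Quotient.mk ⟨x, hx⟩)
  · refine lt_of_le_of_ne (Submodule.map_subtype_le _ _) fun e => hY.1 ?_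
    rw [eq_top_iff]
    rintro ⟨x, hx⟩ -
    rw [← e] at hx
    obtain ⟨y, hy, rfl⟩ := hx
    exact hy

/-- Nakayama's lemma for arbitrary modules over a finite-dimensional algebra. -/
theorem subsingleton_of_forall_isCoatom_smul_top (k : Type*) {R : Type*} [Field k] [Ring R]
    [Algebra k R] [FiniteDimensional k R] (L : Type*) [AddCommGroup L] [Module R L]
    (h : ∀ P : TwoSidedIdeal R, IsCoatom P → (P.asIdeal • ⊤ : Submodule R L) = ⊤) :
    Subsingleton L := by
  obtain ⟨l, hl, h0⟩ := exists_list_isCoatom_foldr_eq_bot k R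
  have key : ∀ l : List (TwoSidedIdeal R), (∀ P ∈ l, IsCoatom P) →
      (l.foldr (fun P (X : Ideal R) => P.asIdeal • X) ⊤) • (⊤ : Submodule R L) = ⊤ := by
    intro l
    induction l with
    | nil => intro _; simp
    | cons P l ih =>
      intro hl
      rw [List.foldr_cons, Submodule.smul_assoc, ih fun P hP => hl P (by simp [hP]),
        h P (hl P (by simp))]
  have := key l hl
  rw [h0, Submodule.bot_smul] at this
  exact (Submodule.subsingleton_iff R).1 (subsingleton_of_bot_eq_top this)

/-- Each maximal ideal contains the zero product of maximal ideals and is prime to those different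
from it, so it must be one of the factors. -/
theorem TwoSidedIdeal.finite_setOf_isCoatom (k R : Type*) [Field k] [Ring R]
    [Algebra k R] [FiniteDimensional k R] : {P : TwoSidedIdeal R | IsCoatom P}.Finite := by
  obtain ⟨l, hl, h0⟩ := exists_list_isCoatom_foldr_eq_bot k R
  refine (List.finite_toSet l).subset fun P (hP : IsCoatom P) => ?_
  have key : ∀ l : List (TwoSidedIdeal R), (∀ P ∈ l, IsCoatom P) →
      l.foldr (fun P (X : Ideal R) => P.asIdeal • X) ⊤ ≤ P.asIdeal → P ∈ l := by
    intro l
    induction l with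
    | nil =>
      intro _ h
      exact absurd (P.one_mem_iff.1 (mem_asIdeal.1 (h trivial))) hP.1
    | cons P' l ih =>
      intro hl h
      by_cases e : P = P'
      · simp [e]
      obtain ⟨y, hy, hy1⟩ := exists_one_sub_mem_of_ne hP (hl P' (by simp)) e
      refine List.mem_cons_of_mem _ (ih (fun P hP => hl P (by simp [hP])) fun x hx => ?_)
      have h1 : y * x ∈ P.asIdeal := h (Submodule.smul_mem_smul (mem_asIdeal.2 hy) hx)
      have h2 : (1 - y) * x ∈ P.asIdeal := P.mul_mem_right _ _ hy1
      simpa [sub_mul] using P.asIdeal.add_mem h2 h1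
  exact key l hl (by rw [h0]; exact bot_le)

/-- Chinese remainder theorem: multiply the elements that separate `P` from each other maximal
ideal. -/
theorem TwoSidedIdeal.exists_one_sub_mem_forall_mem {R : Type*} [Ring R]
    (hfin : {P : TwoSidedIdeal R | IsCoatom P}.Finite) {P : TwoSidedIdeal R} (hP : IsCoatom P) :
    ∃ x : R, 1 - x ∈ P ∧ ∀ P' : TwoSidedIdeal R, IsCoatom P' → P' ≠ P → x ∈ P' := by
  have key : ∀ s : Finset (TwoSidedIdeal R), (∀ P' ∈ s, IsCoatom P') →
      ∃ x : R, 1 - x ∈ P ∧ ∀ P' ∈ s, P' ≠ P → x ∈ P' := by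
    intro s
    classical
    induction s using Finset.induction_on with
    | empty => intro _; exact ⟨1, by simp, by simp⟩
    | insert P' s _ ih =>
      intro hs
      obtain ⟨x, hx, hxs⟩ := ih fun P hP => hs P (by simp [hP])
      by_cases e : P = P'
      · exact ⟨x, hx, fun Q hQ hQP => hxs Q
          ((Finset.mem_insert.1 hQ).resolve_left fun h => hQP (h.trans e.symm)) hQP⟩
      obtain ⟨y, hy, hy1⟩ := exists_one_sub_mem_of_ne hP (hs P' (by simp)) e
      refine ⟨y * x, ?_, fun Q hQ hQP => ?_⟩
      · have := P.add_mem hy1 (P.mul_mem_left y _ hx)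
        rwa [mul_sub, mul_one, sub_add_sub_cancel] at this
      · rcases Finset.mem_insert.1 hQ with rfl | hQ
        · exact Q.mul_mem_right _ _ hy
        · exact Q.mul_mem_left _ _ (hxs Q hQ hQP)
  obtain ⟨x, hx, hxs⟩ := key hfin.toFinset fun P hP => hfin.mem_toFinset.1 hP
  exact ⟨x, hx, fun P' hP' h => hxs P' (hfin.mem_toFinset.2 hP') h⟩

end Nakayama

/-! ### Lifting maps from the reductions modulo all maximal ideals. -/

section Lifting

universe u v w

theorem Submodule.mem_smul_top_finsupp {R : Type*} [Ring R] {ι : Type*} (I : Ideal R)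
    {w : ι →₀ R} (h : ∀ i, w i ∈ I) : w ∈ (I • ⊤ : Submodule R (ι →₀ R)) := by
  rw [← w.sum_single]
  refine Submodule.sum_mem _ fun i _ => ?_
  have : Finsupp.single i (w i) = w i • (Finsupp.single i 1 : ι →₀ R) := by simp
  rw [this]
  exact Submodule.smul_mem_smul (h i) trivial

theorem LinearMap.map_mem_ideal_smul_top {R M N : Type*} [Ring R] [AddCommMonoid M] [Module R M]
    [AddCommMonoid N] [Module R N] (f : M →ₗ[R] N) (I : Ideal R) {x : M}
    (hx : x ∈ (I • ⊤ : Submodule R M)) : f x ∈ (I • ⊤ : Submodule R N) := by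
  have := Submodule.mem_map_of_mem (f := f) hx
  rw [Submodule.map_smul''] at this
  exact Submodule.smul_mono le_rfl le_top this

variable {R : Type u} [Ring R]
  {M : Type v} [AddCommGroup M] [Module R M] {ι : Type w}

theorem Submodule.eq_top_of_forall_isCoatom (k : Type*) {R M : Type*} [Field k] [Ring R]
    [Algebra k R] [FiniteDimensional k R] [AddCommGroup M] [Module R M] {N : Submodule R M}
    (h : ∀ P : TwoSidedIdeal R, IsCoatom P → ∀ m : M, ∃ n ∈ N,
      m - n ∈ (P.asIdeal • ⊤ : Submodule R M)) : N = ⊤ := by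
  rw [← Submodule.Quotient.subsingleton_iff]
  refine subsingleton_of_forall_isCoatom_smul_top k (R := R) _ fun P hP => eq_top_iff.2 ?_
  rintro y -
  obtain ⟨m, rfl⟩ := N.mkQ_surjective y
  obtain ⟨n, hn, hmn⟩ := h P hP m
  have := N.mkQ.map_mem_ideal_smul_top P.asIdeal hmn
  rwa [map_sub, Submodule.mkQ_apply, Submodule.mkQ_apply, (Submodule.Quotient.mk_eq_zero N (x := n)).2 hn, sub_zero] at this

/-- Each basis vector goes to a lift of its prescribed images in all reductions at once, glued with
the Chinese remainder elements `e P`. -/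
theorem exists_linearMap_lift_of_isCoatom (k : Type*) [Field k] [Algebra k R]
    [FiniteDimensional k R]
    (g : ∀ P : {P : TwoSidedIdeal R // IsCoatom P}, (ι →₀ R ⧸ P.1.asIdeal) →ₗ[R ⧸ P.1.asIdeal]
      (M ⧸ (P.1.asIdeal • ⊤ : Submodule R M))) :
    ∃ f : (ι →₀ R) →ₗ[R] M, ∀ P w, Submodule.Quotient.mk (f w) =
      g P (w.mapRange (Ideal.Quotient.mk P.1.asIdeal) (map_zero _)) := by
  have hfin := TwoSidedIdeal.finite_setOf_isCoatom k R
  let _ : Fintype {P : TwoSidedIdeal R // IsCoatom P} := hfin.fintype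
  choose e he he' using fun P : {P : TwoSidedIdeal R // IsCoatom P} =>
    TwoSidedIdeal.exists_one_sub_mem_forall_mem hfin P.2
  choose m hm using fun (P : {P : TwoSidedIdeal R // IsCoatom P}) (i : ι) =>
    Submodule.Quotient.mk_surjective _ (g P (Finsupp.single i 1))
  refine ⟨Finsupp.linearCombination R fun i => ∑ P, e P • m P i, fun P => ?_⟩
  have hz : ∀ r ∈ P.1, ∀ x : M,
      (Submodule.Quotient.mk (r • x) : M ⧸ (P.1.asIdeal • ⊤ : Submodule R M)) = 0 :=
    fun r hr x => (Submodule.Quotient.mk_eq_zero _).2 (Submodule.smul_mem_smul hr trivial)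
  have key : Submodule.mkQ (P.1.asIdeal • ⊤ : Submodule R M) ∘ₗ
      (Finsupp.linearCombination R fun i => ∑ P, e P • m P i) =
      (g P).restrictScalars R ∘ₗ Finsupp.mapRange.linearMap (Submodule.mkQ P.1.asIdeal) := by
    refine Finsupp.lhom_ext' fun i => LinearMap.ext_ring ?_
    have h1 : Submodule.mkQ (P.1.asIdeal • ⊤ : Submodule R M) (∑ P', e P' • m P' i) =
        Submodule.Quotient.mk (m P i) := by
      rw [map_sum, Finset.sum_eq_single P]
      · have := hz _ (he P) (m P i)
        rw [sub_smul, one_smul, Submodule.Quotient.mk_sub, sub_eq_zero] at this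
        exact this.symm
      · exact fun P' _ hP' => hz _ (he' P' P.1 P.2 fun h => hP' (Subtype.ext h.symm)) _
      · exact fun h => absurd (Finset.mem_univ _) h
    have h2 : (Finsupp.mapRange.linearMap (Submodule.mkQ P.1.asIdeal) (Finsupp.single i 1) :
        ι →₀ R ⧸ P.1.asIdeal) = Finsupp.single i 1 := by
      rw [Finsupp.mapRange.linearMap_apply, Finsupp.mapRange_single]; rfl
    simp only [LinearMap.comp_apply, Finsupp.lsingle_apply, Finsupp.linearCombination_single,
      one_smul, LinearMap.restrictScalars_apply]
    rw [h1, h2, hm]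
  exact fun w => LinearMap.congr_fun key w

/-- Surjections onto the reductions modulo all maximal ideals lift; if they are bijective and
the module is projective, then the lift is bijective. -/
theorem exists_linearMap_surjective_of_isCoatom (k : Type*) [Field k] [Algebra k R]
    [FiniteDimensional k R]
    (g : ∀ P : {P : TwoSidedIdeal R // IsCoatom P}, (ι →₀ R ⧸ P.1.asIdeal) →ₗ[R ⧸ P.1.asIdeal]
      (M ⧸ (P.1.asIdeal • ⊤ : Submodule R M)))
    (hg : ∀ P, Function.Surjective (g P)) :
    ∃ f : (ι →₀ R) →ₗ[R] M, Function.Surjective f ∧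
      ((∀ P, Function.Injective (g P)) → Module.Projective R M → Function.Injective f) := by
  obtain ⟨f, hf⟩ := exists_linearMap_lift_of_isCoatom k g
  have hsurj : Function.Surjective f := by
    rw [← LinearMap.range_eq_top]
    refine Submodule.eq_top_of_forall_isCoatom k fun P hP m => ?_
    obtain ⟨w, hw⟩ := hg ⟨P, hP⟩ (Submodule.Quotient.mk m)
    obtain ⟨w, rfl⟩ := Finsupp.mapRange_surjective (Ideal.Quotient.mk P.asIdeal) (map_zero _)
      Ideal.Quotient.mk_surjective w
    refine ⟨f w, ⟨w, rfl⟩, ?_⟩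
    rw [← Submodule.Quotient.eq, ← hw]
    exact (hf ⟨P, hP⟩ w).symm
  refine ⟨f, hsurj, fun hinj hM => ?_⟩
  obtain ⟨s, hs⟩ := Module.projective_lifting_property f LinearMap.id hsurj
  have hs' : ∀ m, f (s m) = m := LinearMap.congr_fun hs
  -- Projection onto the direct summand `ker f`. An element of `ker f` has all coordinates in `P`,
  -- so applying `e` puts it in `P • ker f`, and Nakayama gives `ker f = 0`.
  let e : (ι →₀ R) →ₗ[R] LinearMap.ker f :=
    (LinearMap.id - s ∘ₗ f).codRestrict _ fun w => by simp [hs']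
  have : Subsingleton (LinearMap.ker f) := by
    refine subsingleton_of_forall_isCoatom_smul_top k (R := R) _ fun P hP => eq_top_iff.2 ?_
    rintro ⟨x, hx⟩ -
    have h1 : x ∈ (P.asIdeal • ⊤ : Submodule R (ι →₀ R)) := by
      refine Submodule.mem_smul_top_finsupp _ fun i => ?_
      have h2 := hf ⟨P, hP⟩ x
      rw [LinearMap.mem_ker.1 hx, Submodule.Quotient.mk_zero, eq_comm,
        map_eq_zero_iff _ (hinj ⟨P, hP⟩)] at h2
      exact Ideal.Quotient.eq_zero_iff_mem.1 (DFunLike.congr_fun h2 i)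
    have h3 := e.map_mem_ideal_smul_top P.asIdeal h1
    have h4 : e x = ⟨x, hx⟩ := Subtype.ext (by simp [e, LinearMap.mem_ker.1 hx])
    rwa [h4] at h3
  exact LinearMap.ker_eq_bot.1 ((Submodule.subsingleton_iff_eq_bot).1 this)

theorem exists_linearMap_surjective_of_rank_le (k : Type*) [Field k] [Algebra k R]
    [FiniteDimensional k R] [Module k M] [IsScalarTower k R M]
    (h : ∀ P : TwoSidedIdeal R, IsCoatom P →
      Cardinal.lift.{max u w} (Module.rank k (M ⧸ (P.asIdeal • ⊤ : Submodule R M))) ≤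
        Cardinal.lift.{v} (Module.rank k (ι →₀ R ⧸ P.asIdeal))) :
    ∃ f : (ι →₀ R) →ₗ[R] M, Function.Surjective f ∧
      ((∀ P : TwoSidedIdeal R, IsCoatom P →
        Cardinal.lift.{max u w} (Module.rank k (M ⧸ (P.asIdeal • ⊤ : Submodule R M))) =
          Cardinal.lift.{v} (Module.rank k (ι →₀ R ⧸ P.asIdeal))) →
        Module.Projective R M → Function.Injective f) := by
  have (P : {P : TwoSidedIdeal R // IsCoatom P}) :=
    haveI := TwoSidedIdeal.isSimpleRing_quotient P.2
    haveI : FiniteDimensional k (R ⧸ P.1.asIdeal) :=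
      Module.Finite.of_surjective (Ideal.Quotient.mkₐ k P.1.asIdeal).toLinearMap
        Ideal.Quotient.mk_surjective
    IsSimpleRing.exists_linearMap_of_rank_le (k := k) (B := R ⧸ P.1.asIdeal) (h P.1 P.2)
  choose g hg hg' using this
  obtain ⟨f, hf, hf'⟩ := exists_linearMap_surjective_of_isCoatom k g hg
  exact ⟨f, hf, fun heq => hf' fun P => hg' P (heq P.1 P.2)⟩

end Lifting

/-! ### Injective modules over an algebra with a nondegenerate functional. -/

section Frobenius

variable {k : Type*} {R : Type*} [Field k] [Ring R] [Algebra k R] [FiniteDimensional k R]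

/-- Over an algebra with a nondegenerate functional `lam`, functionals on a module are of the form
`lam ∘ g` with `g` a homomorphism to the regular module. -/
theorem exists_linearMap_comp_eq_functional {lam : R →ₗ[k] k}
    (hlam : ∀ x, (∀ y, lam (y * x) = 0) → x = 0) {X : Type*} [AddCommGroup X] [Module k X]
    [Module R X] [IsScalarTower k R X] (c : X →ₗ[k] k) :
    ∃ g : X →ₗ[R] R, ∀ x, lam (g x) = c x := by
  have huniq : ∀ a b : R, (∀ y, lam (y * a) = lam (y * b)) → a = b := fun a b h =>
    sub_eq_zero.1 (hlam _ fun y => by rw [mul_sub, map_sub, h, sub_self])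
  -- Nondegeneracy makes `x ↦ lam (· * x)` injective, hence onto the dual; `r x` represents the
  -- functional `y ↦ c (y • x)`.
  let Φ : R →ₗ[k] Module.Dual k R := (LinearMap.mul k R).flip.compr₂ lam
  have hΦ : Function.Surjective Φ := by
    refine (LinearMap.injective_iff_surjective_of_finrank_eq_finrank
      (Subspace.dual_finrank_eq (K := k) (V := R)).symm).1 ?_
    exact fun a b h => huniq a b fun y => LinearMap.congr_fun h y
  choose r hr using fun x : X => hΦ (c ∘ₗ (LinearMap.toSpanSingleton R X x).restrictScalars k)
  have hr' : ∀ x y, lam (y * r x) = c (y • x) := fun x y => LinearMap.congr_fun (hr x) y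
  refine ⟨⟨⟨r, fun x y => huniq _ _ fun z => ?_⟩, fun a x => huniq _ _ fun z => ?_⟩, fun x => ?_⟩
  · rw [mul_add, map_add, hr', hr', hr', smul_add, map_add]
  · rw [RingHom.id_apply, smul_eq_mul, ← mul_assoc, hr', hr', mul_smul]
  · simpa using hr' x 1

/-- A map `g : I → R` is determined by the functional `lam ∘ g`, which extends `k`-linearly to `R`
and then comes from an `R`-linear map. -/
theorem Module.Baer.self_of_functional {lam : R →ₗ[k] k}
    (hlam : ∀ x, (∀ y, lam (y * x) = 0) → x = 0) : Module.Baer R R := by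
  intro I g
  obtain ⟨c, hc⟩ := LinearMap.exists_extend (p := I.restrictScalars k)
    (lam ∘ₗ g.restrictScalars k)
  obtain ⟨G, hG⟩ := exists_linearMap_comp_eq_functional hlam c
  refine ⟨G, fun x hx => sub_eq_zero.1 (hlam _ fun y => ?_)⟩
  have h1 : y * (G x - g ⟨x, hx⟩) = G (y * x) - g ⟨y * x, I.mul_mem_left y hx⟩ := by
    rw [mul_sub, ← smul_eq_mul, ← smul_eq_mul y, ← map_smul, ← map_smul]; rfl
  rw [h1, map_sub, hG, sub_eq_zero]
  exact LinearMap.congr_fun hc ⟨y * x, I.mul_mem_left y hx⟩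

/-- The homomorphisms `g i` representing the coordinates of a `k`-basis embed `M` in a free module;
injectivity of `M` splits the embedding. -/
theorem Module.Baer.projective {lam : R →ₗ[k] k}
    (hlam : ∀ x, (∀ y, lam (y * x) = 0) → x = 0) {M : Type*} [AddCommGroup M] [Module k M]
    [Module R M] [IsScalarTower k R M] (hM : Module.Baer R M) : Module.Projective R M := by
  let b := Module.Free.chooseBasis k M
  let y := Module.finBasis k R
  choose g hg using fun i => exists_linearMap_comp_eq_functional hlam (b.coord i)
  -- If `g i m ≠ 0`, then the `i`-th coordinate of `y j • m` is nonzero for some member of the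
  -- finite basis `y` of `R`.
  have hfin : ∀ m : M, (Function.support fun i => g i m).Finite := fun m => by
    refine (Set.finite_iUnion fun j => (b.repr (y j • m)).hasFiniteSupport).subset fun i hi => ?_
    by_contra h
    simp only [Set.mem_iUnion, not_exists, Function.notMem_support] at h
    refine hi (hlam _ fun z => ?_)
    rw [← smul_eq_mul, ← map_smul, hg]
    rw [← y.sum_repr z, Finset.sum_smul, map_sum]
    exact Finset.sum_eq_zero fun j _ => by
      rw [smul_assoc, map_smul, Module.Basis.coord_apply, h j, smul_zero]
  let G : M →ₗ[R] (Module.Free.ChooseBasisIndex k M →₀ R) :=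
    { toFun := fun m => Finsupp.ofSupportFinite (fun i => g i m) (hfin m)
      map_add' := fun a b => Finsupp.ext fun i => map_add (g i) a b
      map_smul' := fun a b => Finsupp.ext fun i => map_smul (g i) a b }
  have hG : Function.Injective G := by
    refine (injective_iff_map_eq_zero G).2 fun m hm => b.repr.map_eq_zero_iff.1 ?_
    ext i
    have : g i m = 0 := DFunLike.congr_fun hm i
    rw [← b.coord_apply, ← hg, this, map_zero, Finsupp.zero_apply]
  obtain ⟨s, hs⟩ := hM.extension_property G hG LinearMap.id
  exact Module.Projective.of_split G s hs

end Frobenius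

/-! ### Modules with a free power and their ranks. -/

section FreePower

/-- Some nonzero finite power of `N` is free of finite rank. -/
def HasFreePower (R N : Type*) [Ring R] [AddCommGroup N] [Module R N] : Prop :=
  ∃ l n : ℕ, 0 < l ∧ Nonempty ((Fin l → N) ≃ₗ[R] (Fin n → R))

theorem HasFreePower.congr {R N N' : Type*} [Ring R] [AddCommGroup N] [Module R N]
    [AddCommGroup N'] [Module R N'] (h : HasFreePower R N) (e : N ≃ₗ[R] N') :
    HasFreePower R N' := by
  obtain ⟨l, n, hl, ⟨f⟩⟩ := h
  exact ⟨l, n, hl, ⟨(LinearEquiv.piCongrRight fun _ => e.symm).trans f⟩⟩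

/-- `N` is a direct summand of the injective module `R^n`. -/
theorem HasFreePower.baer {R N : Type*} [Ring R] [AddCommGroup N] [Module R N]
    (h : HasFreePower R N) (hR : Module.Baer R R) : Module.Baer R N := by
  obtain ⟨l, n, hl, ⟨e⟩⟩ := h
  intro I g
  let i0 : Fin l := ⟨0, hl⟩
  choose G hG using fun j : Fin n =>
    hR I (LinearMap.proj j ∘ₗ e.toLinearMap ∘ₗ LinearMap.single R (fun _ => N) i0 ∘ₗ g)
  refine ⟨LinearMap.proj i0 ∘ₗ e.symm.toLinearMap ∘ₗ LinearMap.pi G, fun x hx => ?_⟩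
  have : LinearMap.pi G x = e (Pi.single i0 (g ⟨x, hx⟩)) := funext fun j => hG j x hx
  simp [this]

theorem Submodule.ideal_smul_top_pi {R M : Type*} [Ring R] [AddCommGroup M] [Module R M]
    {ι : Type*} [Fintype ι] (I : Ideal R) :
    (I • ⊤ : Submodule R (ι → M)) = Submodule.pi Set.univ fun _ => I • ⊤ := by
  classical
  refine le_antisymm (fun x hx i _ => (LinearMap.proj i).map_mem_ideal_smul_top I hx)
    fun x hx => ?_
  rw [← Finset.univ_sum_single x]
  exact Submodule.sum_mem _ fun i _ =>
    (LinearMap.single R (fun _ => M) i).map_mem_ideal_smul_top I (hx i trivial)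

theorem finrank_quotient_smul_top_pi (k : Type*) {R : Type*} [Field k] [Ring R] [Algebra k R]
    {M : Type*} [AddCommGroup M] [Module k M] [Module R M] [IsScalarTower k R M]
    [Module.Finite k M] (I : Ideal R) (l : ℕ) :
    Module.finrank k ((Fin l → M) ⧸ (I • ⊤ : Submodule R (Fin l → M))) =
      l * Module.finrank k (M ⧸ (I • ⊤ : Submodule R M)) := by
  let f : (Fin l → M) →ₗ[R] (Fin l → M ⧸ (I • ⊤ : Submodule R M)) :=
    LinearMap.pi fun i => (I • ⊤ : Submodule R M).mkQ ∘ₗ LinearMap.proj i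
  have hf : Function.Surjective f := fun y => by
    choose x hx using fun i => Submodule.mkQ_surjective _ (y i)
    exact ⟨x, funext hx⟩
  have hker : (I • ⊤ : Submodule R (Fin l → M)) = LinearMap.ker f := by
    ext x
    simp [Submodule.ideal_smul_top_pi, f, funext_iff, Submodule.Quotient.mk_eq_zero]
  have e := (Submodule.quotEquivOfEq _ _ hker).trans (f.quotKerEquivOfSurjective hf)
  refine (e.restrictScalars k).finrank_eq.trans ?_
  rw [Module.finrank_pi_fintype]
  simp

theorem LinearEquiv.finrank_quotient_smul_top_eq (k : Type*) {R : Type*} [Field k] [Ring R]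
    [Algebra k R] {M N : Type*} [AddCommGroup M] [Module k M] [Module R M] [IsScalarTower k R M]
    [AddCommGroup N] [Module k N] [Module R N] [IsScalarTower k R N]
    (e : M ≃ₗ[R] N) (I : Ideal R) :
    Module.finrank k (M ⧸ (I • ⊤ : Submodule R M)) =
      Module.finrank k (N ⧸ (I • ⊤ : Submodule R N)) := by
  refine ((Submodule.Quotient.equiv _ _ e ?_).restrictScalars k).finrank_eq
  rw [Submodule.map_smul'']
  simp

theorem HasFreePower.exists_finrank_eq (k : Type*) {R : Type*} [Field k] [Ring R] [Algebra k R]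
    [FiniteDimensional k R] {M : Type*} [AddCommGroup M] [Module k M] [Module R M]
    [IsScalarTower k R M] [Module.Finite k M] (h : HasFreePower R M) :
    ∃ l n : ℕ, 0 < l ∧ l * Module.finrank k M = n * Module.finrank k R ∧
      ∀ P : TwoSidedIdeal R,
        l * Module.finrank k (M ⧸ (P.asIdeal • ⊤ : Submodule R M)) =
          n * Module.finrank k (R ⧸ P.asIdeal) := by
  obtain ⟨l, n, hl, ⟨e⟩⟩ := h
  refine ⟨l, n, hl, ?_, fun P => ?_⟩
  · have := (e.restrictScalars k).finrank_eq
    simpa [Module.finrank_pi_fintype] using this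
  · rw [← finrank_quotient_smul_top_pi k, e.finrank_quotient_smul_top_eq k,
      finrank_quotient_smul_top_pi k, smul_eq_mul, Ideal.mul_top]

theorem TwoSidedIdeal.finrank_quotient_pos (k : Type*) {R : Type*} [Field k] [Ring R]
    [Algebra k R] [FiniteDimensional k R] {P : TwoSidedIdeal R} (hP : IsCoatom P) :
    0 < Module.finrank k (R ⧸ P.asIdeal) :=
  haveI := TwoSidedIdeal.isSimpleRing_quotient hP
  Module.finrank_pos

/-- For modules with a free power, the ratio of the dimension to that of `R` equals the rank at
every `P`. As `U/PU` maps onto `V/PV`, the rank of `V` is at most that of `U`, so `dim V ≤ dim U`.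
-/
theorem HasFreePower.eq_top_of_forall_sub_mem (k : Type*) {R : Type*} [Field k] [Ring R]
    [Algebra k R] [FiniteDimensional k R] {V : Type*} [AddCommGroup V] [Module k V] [Module R V]
    [IsScalarTower k R V] [Module.Finite k V] (hV : HasFreePower R V) {U : Submodule R V}
    (hU : HasFreePower R U) {P : TwoSidedIdeal R} (hP : IsCoatom P)
    (h : ∀ v : V, ∃ u ∈ U, v - u ∈ (P.asIdeal • ⊤ : Submodule R V)) : U = ⊤ := by
  have hUfin : Module.Finite k U := inferInstanceAs (Module.Finite k (U.restrictScalars k))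
  obtain ⟨l, n, hl, hV1, hV2⟩ := hV.exists_finrank_eq k
  obtain ⟨l', n', hl', hU1, hU2⟩ := hU.exists_finrank_eq k
  have hpos := TwoSidedIdeal.finrank_quotient_pos k hP
  let q : (U ⧸ (P.asIdeal • ⊤ : Submodule R U)) →ₗ[R] (V ⧸ (P.asIdeal • ⊤ : Submodule R V)) :=
    Submodule.mapQ _ _ U.subtype fun x hx => U.subtype.map_mem_ideal_smul_top _ hx
  have hq : Function.Surjective q := fun y => by
    obtain ⟨v, rfl⟩ := Submodule.Quotient.mk_surjective _ y
    obtain ⟨u, hu, huv⟩ := h v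
    exact ⟨Submodule.Quotient.mk ⟨u, hu⟩, ((Submodule.Quotient.eq _).2 huv).symm⟩
  have hle := LinearMap.finrank_le_finrank_of_surjective (f := q.restrictScalars k) hq
  have hnn : l' * n ≤ l * n' := by
    refine Nat.le_of_mul_le_mul_right ?_ hpos
    rw [mul_assoc, mul_assoc, ← hV2 P, ← hU2 P, mul_left_comm]
    gcongr
  have hdim : Module.finrank k V ≤ Module.finrank k U := by
    refine Nat.le_of_mul_le_mul_left ?_ (Nat.mul_pos hl hl')
    calc l * l' * Module.finrank k V = l' * n * Module.finrank k R := by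
          rw [mul_assoc l' n, ← hV1]; ring
      _ ≤ l * n' * Module.finrank k R := by gcongr
      _ = l * l' * Module.finrank k U := by rw [mul_assoc l n', ← hU1]; ring
  have : U.restrictScalars k = ⊤ :=
    Submodule.eq_top_of_finrank_eq (le_antisymm (Submodule.finrank_le _) hdim)
  exact (Submodule.restrictScalars_eq_top_iff k R V).1 this

end FreePower

/-! ### Arbitrary modules exhausted by finitely generated submodules with free powers. -/

section Family

universe u v

/-- A family of submodules of `M`, closed under sums and intersections, which exhausts `M` by
finitely generated members all of which have a free finite power. -/
structure IsFreePowerFamily {R M : Type*} [Ring R] [AddCommGroup M] [Module R M]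
    (L : Set (Submodule R M)) : Prop where
  sSup_mem : ∀ {T : Set (Submodule R M)}, T ⊆ L → sSup T ∈ L
  inf_mem : ∀ {N N' : Submodule R M}, N ∈ L → N' ∈ L → N ⊓ N' ∈ L
  exists_finite : ∀ x : M, ∃ N ∈ L, x ∈ N ∧ Module.Finite R N
  hasFreePower : ∀ {N : Submodule R M}, N ∈ L → Module.Finite R N → HasFreePower R N

namespace IsFreePowerFamily

variable {R : Type u} {M : Type v} [Ring R] [AddCommGroup M] [Module R M]
  {L : Set (Submodule R M)}

theorem sup_mem (hL : IsFreePowerFamily L) {N N' : Submodule R M} (h : N ∈ L) (h' : N' ∈ L) :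
    N ⊔ N' ∈ L := by
  rw [← sSup_pair]
  exact hL.sSup_mem (Set.insert_subset h (Set.singleton_subset_iff.2 h'))

theorem top_mem (hL : IsFreePowerFamily L) : ⊤ ∈ L := by
  have : sSup L = ⊤ := eq_top_iff.2 fun x _ => by
    obtain ⟨N, hN, hx, -⟩ := hL.exists_finite x
    exact le_sSup hN hx
  exact this ▸ hL.sSup_mem subset_rfl

theorem exists_le_of_fg [IsNoetherianRing R] (hL : IsFreePowerFamily L) {U : Submodule R M}
    (hU : U ∈ L) {F : Submodule R M} (hF : F.FG) (hFU : F ≤ U) :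
    ∃ N ∈ L, F ≤ N ∧ N ≤ U ∧ Module.Finite R N := by
  induction F, hF using Submodule.fg_induction with
  | singleton x =>
    obtain ⟨N, hN, hx, hfin⟩ := hL.exists_finite x
    refine ⟨N ⊓ U, hL.inf_mem hN hU, ?_, inf_le_right,
      Module.Finite.of_injective (Submodule.inclusion inf_le_left)
        (Submodule.inclusion_injective _)⟩
    exact le_inf ((Submodule.span_singleton_le_iff_mem _ _).2 hx) hFU
  | sup F F' _ _ ih ih' =>
    obtain ⟨N, hN, h1, h2, h3⟩ := ih (le_sup_left.trans hFU)
    obtain ⟨N', hN', h1', h2', h3'⟩ := ih' (le_sup_right.trans hFU)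
    refine ⟨N ⊔ N', hL.sup_mem hN hN', sup_le_sup h1 h1', sup_le h2 h2', ?_⟩
    exact Module.Finite.iff_fg.2 ((Module.Finite.iff_fg.1 h3).sup (Module.Finite.iff_fg.1 h3'))

/-- Left ideals are finitely generated, so a map from one into `U` lands in a finitely generated
member of `L`, which is injective. -/
theorem baer [IsNoetherianRing R] (hL : IsFreePowerFamily L) (hR : Module.Baer R R)
    {U : Submodule R M} (hU : U ∈ L) : Module.Baer R U := by
  intro I g
  obtain ⟨N, hN, h1, h2, hfin⟩ := hL.exists_le_of_fg hU
    (F := (LinearMap.range g).map U.subtype)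
    ((LinearMap.range_eq_map g ▸ (IsNoetherian.noetherian (⊤ : Submodule R I)).map g).map _) (Submodule.map_subtype_le _ _)
  have hgN : ∀ x, (U.subtype ∘ₗ g) x ∈ N := fun x => h1 ⟨g x, ⟨x, rfl⟩, rfl⟩
  obtain ⟨G, hG⟩ := (hL.hasFreePower hN hfin).baer hR I ((U.subtype ∘ₗ g).codRestrict N hgN)
  exact ⟨Submodule.inclusion h2 ∘ₗ G, fun x hx => Subtype.ext (by
    simpa using congrArg Subtype.val (hG x hx))⟩

theorem baer_self [IsNoetherianRing R] (hL : IsFreePowerFamily L) (hR : Module.Baer R R) :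
    Module.Baer R M :=
  (hL.baer hR hL.top_mem).of_equiv Submodule.topEquiv

theorem hasFreePower_self [Module.Finite R M] (hL : IsFreePowerFamily L) : HasFreePower R M :=
  (hL.hasFreePower hL.top_mem (Module.Finite.equiv Submodule.topEquiv.symm)).congr
    Submodule.topEquiv

/-- A one-prime Nakayama lemma: for each finitely generated member `V`, the hypothesis descends to
`N ⊓ V ≤ V`, where ranks can be compared. -/
theorem eq_top_of_forall_sub_mem (k : Type*) [Field k] [Algebra k R] [FiniteDimensional k R]
    [Module k M] [IsScalarTower k R M]
    (hL : IsFreePowerFamily L) (hR : Module.Baer R R) {N : Submodule R M} (hN : N ∈ L)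
    {P : TwoSidedIdeal R} (hP : IsCoatom P)
    (h : ∀ m : M, ∃ n ∈ N, m - n ∈ (P.asIdeal • ⊤ : Submodule R M)) : N = ⊤ := by
  have : IsNoetherianRing R := IsNoetherianRing.of_finite k R
  refine eq_top_iff.2 fun x _ => ?_
  obtain ⟨V, hV, hx, hfin⟩ := hL.exists_finite x
  have hVk : Module.Finite k V := Module.Finite.trans R V
  have hUfin : Module.Finite R (N ⊓ V : Submodule R M) :=
    Module.Finite.of_injective (Submodule.inclusion inf_le_right)
        (Submodule.inclusion_injective _)
  have hU := (hL.hasFreePower (hL.inf_mem hN hV) hUfin).congr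
    (Submodule.comapSubtypeEquivOfLe (p := N ⊓ V) (q := V) inf_le_right).symm
  suffices hs : ((N ⊓ V).comap V.subtype) = ⊤ by
    have : (⟨x, hx⟩ : V) ∈ (N ⊓ V).comap V.subtype := hs ▸ trivial
    exact this.1
  refine (hL.hasFreePower hV hfin).eq_top_of_forall_sub_mem k hU hP fun v => ?_
  obtain ⟨n, hn, hvn⟩ := h v
  -- `N ⊔ V` is injective, hence a direct summand of `M`; the retraction `s` gives `PM ∩ (N + V) =
  -- PN + PV`.
  obtain ⟨s, hs⟩ := (hL.baer hR (hL.sup_mem hN hV)).extension_property (N ⊔ V).subtype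
    (Submodule.injective_subtype _) LinearMap.id
  have hvn' : (v : M) - n ∈ N ⊔ V :=
    Submodule.sub_mem _ (Submodule.mem_sup_right v.2) (Submodule.mem_sup_left hn)
  have h1 : (⟨(v : M) - n, hvn'⟩ : (N ⊔ V : Submodule R M)) ∈
      (P.asIdeal • ⊤ : Submodule R (N ⊔ V : Submodule R M)) := by
    have := s.map_mem_ideal_smul_top P.asIdeal hvn
    rwa [show s ((v : M) - n) = ⟨(v : M) - n, hvn'⟩ from
      LinearMap.congr_fun hs ⟨(v : M) - n, hvn'⟩] at this
  have h2 : (v : M) - n ∈ P.asIdeal • (N ⊔ V) := by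
    have := Submodule.mem_map_of_mem (f := (N ⊔ V).subtype) h1
    rwa [Submodule.map_smul'', Submodule.map_top, Submodule.range_subtype] at this
  rw [Submodule.smul_sup] at h2
  -- From `v - n = a + b` with `a ∈ PN` and `b ∈ PV`, the element `v - b = n + a` lies in `N ⊓ V`
  -- and is congruent to `v` modulo `PV`.
  obtain ⟨a, ha, b, hb, hab⟩ := Submodule.mem_sup.1 h2
  have hbV : b ∈ V := Submodule.smul_le_right hb
  have hba : (v : M) - b = n + a := by rw [sub_eq_iff_eq_add, add_assoc, hab]; abel
  refine ⟨v - ⟨b, hbV⟩, Submodule.mem_comap.2 ⟨?_, V.sub_mem v.2 hbV⟩, ?_⟩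
  · change (v : M) - b ∈ N
    rw [hba]
    exact N.add_mem hn (Submodule.smul_le_right ha)
  · rw [sub_sub_cancel]
    have h3 : b ∈ (P.asIdeal • ⊤ : Submodule R V).map V.subtype := by
      rwa [Submodule.map_smul'', Submodule.map_top, Submodule.range_subtype]
    obtain ⟨c, hc, rfl⟩ := h3
    exact hc

/-- Finitely many finitely generated subspaces cannot span `M`; infinitely many have total dimension
at most `ℵ₀ * #ι = #ι`. -/
theorem _root_.Module.infinite_and_rank_le_of_iSup_eq_top {k : Type*} {M ι : Type v} [Field k]
    [AddCommGroup M] [Module k M] (hM : ¬ Module.Finite k M) {N : ι → Submodule k M}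
    (hN : ∀ i, (N i).FG) (htop : ⨆ i, N i = ⊤) :
    Infinite ι ∧ Module.rank k M ≤ Cardinal.mk ι := by
  choose s hs using hN
  have hspan : Submodule.span k (⋃ i, (s i : Set M)) = ⊤ := by
    rw [Submodule.span_iUnion, ← htop]
    exact iSup_congr hs
  have hinf : Infinite ι := by
    by_contra hcon
    rw [not_infinite_iff_finite] at hcon
    refine hM ⟨?_⟩
    rw [← hspan]
    exact Submodule.fg_span (Set.finite_iUnion fun i => (s i).finite_toSet)
  refine ⟨hinf, ?_⟩
  have h1 := rank_span_le (R := k) (⋃ i, (s i : Set M))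
  rw [hspan, rank_top] at h1
  refine h1.trans (Cardinal.mk_iUnion_le_sum_mk.trans ?_)
  refine (Cardinal.sum_le_sum _ (fun _ => Cardinal.aleph0)
    fun i => (Cardinal.lt_aleph0_of_finite (s i : Set M)).le).trans ?_
  rw [Cardinal.sum_const]
  simp

/-- Put a lift of each basis vector of `M/PM` in a finitely generated member; their sum belongs to
`L` and maps onto `M/PM`, so it is `M`. -/
theorem exists_iSup_eq_top (k : Type*) [Field k] [Algebra k R] [FiniteDimensional k R]
    [Module k M] [IsScalarTower k R M] (hL : IsFreePowerFamily L) (hR : Module.Baer R R)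
    {P : TwoSidedIdeal R} (hP : IsCoatom P) {ι : Type*}
    (b : Module.Basis ι k (M ⧸ (P.asIdeal • ⊤ : Submodule R M))) :
    ∃ N : ι → Submodule R M, (∀ i, Module.Finite R (N i)) ∧ ⨆ i, N i = ⊤ := by
  choose x hx using fun i => Submodule.Quotient.mk_surjective _ (b i)
  choose N hN hxN hfin using fun i => hL.exists_finite (x i)
  refine ⟨N, hfin, hL.eq_top_of_forall_sub_mem k hR
    (hL.sSup_mem (Set.range_subset_iff.2 hN)) hP fun m => ?_⟩
  refine ⟨(b.repr (Submodule.Quotient.mk m)).sum fun i c => c • x i, ?_, ?_⟩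
  · exact Submodule.sum_mem _ fun i _ => Submodule.smul_of_tower_mem _ _
      (Submodule.mem_iSup_of_mem i (hxN i))
  · have h1 : (P.asIdeal • ⊤ : Submodule R M).mkQ
        ((b.repr (Submodule.Quotient.mk m)).sum fun i c => c • x i) =
        (b.repr (Submodule.Quotient.mk m)).sum fun i c => c • b i := by
      rw [map_finsuppSum]
      refine Finsupp.sum_congr fun i _ => ?_
      rw [← hx i]
      rfl
    have h2 : (b.repr (Submodule.Quotient.mk m)).sum (fun i c => c • b i) =
        Submodule.Quotient.mk m := by
      rw [← Finsupp.linearCombination_apply, b.linearCombination_repr]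
    exact (Submodule.Quotient.eq _).1 (h1.trans h2).symm

theorem _root_.Submodule.iSup_restrictScalars_eq_top {k R M ι : Type*} [Semiring k] [Semiring R]
    [AddCommMonoid M] [Module k M] [Module R M] [SMul k R] [IsScalarTower k R M]
    {N : ι → Submodule R M} (h : ⨆ i, N i = ⊤) : ⨆ i, (N i).restrictScalars k = ⊤ := by
  refine eq_top_iff.2 fun m _ => ?_
  have hm : m ∈ ⨆ i, N i := by rw [h]; trivial
  exact Submodule.iSup_induction N
    (motive := fun m => m ∈ ⨆ i, (N i).restrictScalars k)
    hm (fun i y hy => Submodule.mem_iSup_of_mem i hy) (Submodule.zero_mem _)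
    fun y z => Submodule.add_mem _

theorem _root_.rank_quotient_smul_top_le (k : Type*) {R M : Type*} [Field k] [Ring R] [Algebra k R]
    [AddCommGroup M] [Module k M] [Module R M] [IsScalarTower k R M] (I : Ideal R) :
    Module.rank k (M ⧸ (I • ⊤ : Submodule R M)) ≤ Module.rank k M := by
  generalize (I • ⊤ : Submodule R M) = N
  exact LinearMap.rank_le_of_surjective (N.mkQ.restrictScalars k) N.mkQ_surjective

theorem rank_quotient_eq (k : Type*) [Field k] [Algebra k R] [FiniteDimensional k R]
    [Module k M] [IsScalarTower k R M]
    (hL : IsFreePowerFamily L) (hR : Module.Baer R R) (hM : ¬ Module.Finite R M)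
    {P : TwoSidedIdeal R} (hP : IsCoatom P) :
    Module.rank k (M ⧸ (P.asIdeal • ⊤ : Submodule R M)) = Module.rank k M := by
  obtain ⟨⟨ι, b⟩⟩ := Module.Free.exists_basis k (M ⧸ (P.asIdeal • ⊤ : Submodule R M))
  obtain ⟨N, hfin, htop⟩ := hL.exists_iSup_eq_top k hR hP b
  have hNk : ∀ i, ((N i).restrictScalars k).FG := fun i => by
    have h1 : Module.Finite k (N i) := Module.Finite.trans R (N i)
    exact Module.Finite.iff_fg.1 h1
  have h1 := (Module.infinite_and_rank_le_of_iSup_eq_top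
    (fun h => hM (Module.Finite.of_restrictScalars_finite k R M)) hNk
    (Submodule.iSup_restrictScalars_eq_top htop)).2
  rw [b.mk_eq_rank''] at h1
  refine le_antisymm ?_ h1
  exact rank_quotient_smul_top_le k P.asIdeal

/-- All reductions of `M` have dimension `dim M`, as do those of the free module on a `k`-basis of
`M`. -/
theorem free_of_not_finite (k : Type*) [Field k] [Algebra k R] [FiniteDimensional k R]
    [Module k M] [IsScalarTower k R M]
    (hL : IsFreePowerFamily L) (hR : Module.Baer R R) (hproj : Module.Projective R M)
    (hM : ¬ Module.Finite R M) : Module.Free R M := by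
  let ι := Module.Free.ChooseBasisIndex k M
  have hinf : Infinite ι := by
    by_contra hcon
    rw [not_infinite_iff_finite] at hcon
    have : Module.Finite k M := Module.Finite.of_basis (ι := ι) (Module.Free.chooseBasis k M)
    exact hM (Module.Finite.of_restrictScalars_finite k R M)
  have heq : ∀ P : TwoSidedIdeal R, IsCoatom P →
      Cardinal.lift.{max u v} (Module.rank k (M ⧸ (P.asIdeal • ⊤ : Submodule R M))) =
        Cardinal.lift.{v} (Module.rank k (ι →₀ R ⧸ P.asIdeal)) := fun P hP => by
    have : FiniteDimensional k (R ⧸ P.asIdeal) :=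
      Module.Finite.of_surjective (Ideal.Quotient.mkₐ k P.asIdeal).toLinearMap
        Ideal.Quotient.mk_surjective
    have hb : Module.rank k M = Cardinal.mk ι := (Module.Free.chooseBasis k M).mk_eq_rank''.symm
    rw [hL.rank_quotient_eq k hR hM hP, rank_finsupp, ← Module.finrank_eq_rank k (R ⧸ _), hb]
    have h1 : (Module.finrank k (R ⧸ P.asIdeal) : Cardinal.{max u v}) ≠ 0 :=
      Nat.cast_ne_zero.2 (TwoSidedIdeal.finrank_quotient_pos k hP).ne'
    -- An infinite cardinal absorbs the nonzero finite factor `dim (R/P)`.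
    rw [Cardinal.lift_natCast, Cardinal.mul_eq_left (by simp)
      ((Cardinal.natCast_lt_aleph0).le.trans (by simp)) h1]
    simp
  obtain ⟨f, hf, hf'⟩ := exists_linearMap_surjective_of_rank_le k (ι := ι) fun P hP =>
    (heq P hP).le
  exact Module.Free.of_equiv (LinearEquiv.ofBijective f ⟨hf' heq hproj, hf⟩)

/-- The rank `n / l` is the same at every maximal ideal; freeness at `Q` makes it an integer `m`,
and `R^m → M` is then bijective by lifting. -/
theorem _root_.HasFreePower.free_of_quotient (k : Type*) [Field k] [Algebra k R]
    [FiniteDimensional k R] [Module k M] [IsScalarTower k R M] [Module.Finite k M]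
    (h : HasFreePower R M) (hproj : Module.Projective R M)
    {Q : TwoSidedIdeal R} (hQ : IsCoatom Q)
    (hfree : Module.Free (R ⧸ Q.asIdeal) (M ⧸ (Q.asIdeal • ⊤ : Submodule R M))) :
    Module.Free R M := by
  obtain ⟨l, n, hl, -, h2⟩ := h.exists_finrank_eq k
  have := TwoSidedIdeal.isSimpleRing_quotient hQ
  have hq : ∀ P : TwoSidedIdeal R, FiniteDimensional k (R ⧸ P.asIdeal) := fun P =>
      Module.Finite.of_surjective (Ideal.Quotient.mkₐ k P.asIdeal).toLinearMap
        Ideal.Quotient.mk_surjective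
  have : Module.Finite (R ⧸ Q.asIdeal) (M ⧸ (Q.asIdeal • ⊤ : Submodule R M)) :=
    Module.Finite.of_restrictScalars_finite k _ _
  let b := Module.Free.chooseBasis (R ⧸ Q.asIdeal) (M ⧸ (Q.asIdeal • ⊤ : Submodule R M))
  set m := Fintype.card (Module.Free.ChooseBasisIndex (R ⧸ Q.asIdeal)
    (M ⧸ (Q.asIdeal • ⊤ : Submodule R M)))
  have hm : Module.finrank k (M ⧸ (Q.asIdeal • ⊤ : Submodule R M)) =
      m * Module.finrank k (R ⧸ Q.asIdeal) := by
    rw [(b.equivFun.restrictScalars k).finrank_eq, Module.finrank_pi_fintype]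
    simp [m]
  have hn : l * m = n := by
    have := h2 Q
    rw [hm, ← mul_assoc] at this
    exact Nat.eq_of_mul_eq_mul_right (TwoSidedIdeal.finrank_quotient_pos k hQ) this
  have hP : ∀ P : TwoSidedIdeal R, Module.finrank k (M ⧸ (P.asIdeal • ⊤ : Submodule R M)) =
      m * Module.finrank k (R ⧸ P.asIdeal) := fun P =>
    Nat.eq_of_mul_eq_mul_left hl (by rw [h2 P, ← hn, mul_assoc])
  have heq : ∀ P : TwoSidedIdeal R, IsCoatom P →
      Cardinal.lift.{u} (Module.rank k (M ⧸ (P.asIdeal • ⊤ : Submodule R M))) =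
        Cardinal.lift.{v} (Module.rank k (Fin m →₀ R ⧸ P.asIdeal)) := fun P _ => by
    have := hq P
    rw [← Module.finrank_eq_rank, hP P, rank_finsupp, ← Module.finrank_eq_rank]
    simp [-Module.finrank_eq_rank]
  obtain ⟨f, hf, hf'⟩ := exists_linearMap_surjective_of_rank_le k (ι := Fin m) fun P hP =>
    (heq P hP).le
  exact Module.Free.of_equiv (LinearEquiv.ofBijective f ⟨hf' heq hproj, hf⟩)

end IsFreePowerFamily

theorem Module.Free.quotient_smul_top {R M : Type*} [Ring R] [AddCommGroup M] [Module R M]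
    [Module.Free R M] (I : Ideal R) [I.IsTwoSided] :
    Module.Free (R ⧸ I) (M ⧸ (I • ⊤ : Submodule R M)) := by
  let b := Module.Free.chooseBasis R M
  have hmem : ∀ m ∈ (I • ⊤ : Submodule R M), ∀ i, b.repr m i ∈ I := fun m hm i => by
    have := (b.coord i).map_mem_ideal_smul_top I hm
    rwa [smul_eq_mul, Ideal.mul_top] at this
  refine Module.Free.of_basis (Module.Basis.mk
    (v := fun i => (Submodule.Quotient.mk (b i) : M ⧸ (I • ⊤ : Submodule R M))) ?_ ?_)
  · rw [linearIndependent_iff]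
    intro w hw
    obtain ⟨w, rfl⟩ := Finsupp.mapRange_surjective (Ideal.Quotient.mk I) (map_zero _)
      Ideal.Quotient.mk_surjective w
    have h1 : Finsupp.linearCombination R b w ∈ (I • ⊤ : Submodule R M) := by
      rw [← Submodule.Quotient.mk_eq_zero, ← hw, ← Submodule.mkQ_apply,
        Finsupp.linearCombination_apply, Finsupp.linearCombination_apply,
        Finsupp.sum_mapRange_index (by simp), map_finsuppSum]
      rfl
    ext i
    have := hmem _ h1 i
    rw [b.repr_linearCombination] at this
    exact Ideal.Quotient.eq_zero_iff_mem.2 this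
  · rintro y -
    obtain ⟨m, rfl⟩ := Submodule.Quotient.mk_surjective _ y
    have hspan : Submodule.span R (Set.range b) ≤ ((Submodule.span (R ⧸ I) (Set.range fun i =>
        (Submodule.Quotient.mk (b i) : M ⧸ (I • ⊤ : Submodule R M)))).restrictScalars R).comap
        (Submodule.mkQ _) := by
      refine Submodule.span_le.2 ?_
      rintro _ ⟨i, rfl⟩
      exact Submodule.subset_span ⟨i, rfl⟩
    exact hspan (b.mem_span m)

namespace IsFreePowerFamily

theorem projective_and_free_iff {k R M : Type*} [Field k] [Ring R] [Algebra k R]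
    [FiniteDimensional k R] [Nontrivial R] [AddCommGroup M] [Module k M] [Module R M]
    [IsScalarTower k R M] {L : Set (Submodule R M)} (hL : IsFreePowerFamily L) {lam : R →ₗ[k] k}
    (hlam : ∀ x, (∀ y, lam (y * x) = 0) → x = 0) :
    Module.Projective R M ∧ (Module.Free R M ↔ ∃ Q : TwoSidedIdeal R, IsCoatom Q ∧
      Module.Free (R ⧸ Q.asIdeal) (M ⧸ (Q.asIdeal • ⊤ : Submodule R M))) := by
  have : IsNoetherianRing R := IsNoetherianRing.of_finite k R
  have hR := Module.Baer.self_of_functional hlam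
  have hproj := (hL.baer_self hR).projective hlam
  refine ⟨hproj, fun h => ?_, fun ⟨Q, hQ, hfree⟩ => ?_⟩
  · obtain ⟨Q, hQ, -⟩ := TwoSidedIdeal.exists_coatom_ge (bot_ne_top : (⊥ : TwoSidedIdeal R) ≠ ⊤)
    exact ⟨Q, hQ, Module.Free.quotient_smul_top _⟩
  · by_cases hM : Module.Finite R M
    · have : Module.Finite k M := Module.Finite.trans R M
      exact hL.hasFreePower_self.free_of_quotient k hproj hQ hfree
    · exact hL.free_of_not_finite k hR hproj hM

end IsFreePowerFamily

end Family

/-! ### Weak finiteness of `H` for maps between free right modules. -/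

section WeaklyFinite

variable {k H : Type*} [Field k] [Ring H] [Algebra k H]

/-- Right multiplication by `h` on `V ⊗ H`. -/
abbrev tensorMulRight (k : Type*) {H : Type*} [Field k] [Ring H] [Algebra k H] (V : Type*)
    [AddCommGroup V] [Module k V] (h : H) : V ⊗[k] H →ₗ[k] V ⊗[k] H :=
  (LinearMap.mulRight k h).lTensor V

/-- Over a weakly finite algebra, surjective homomorphisms between free right modules of the same
finite rank are injective. -/
theorem IsStablyFiniteRing.injective_of_surjective_tensor (hH : IsStablyFiniteRing H)
    {V W : Type*} [AddCommGroup V] [Module k V] [Module.Finite k V] [AddCommGroup W] [Module k W]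
    [Module.Finite k W] (hVW : Module.finrank k V = Module.finrank k W)
    (f : V ⊗[k] H →ₗ[k] W ⊗[k] H)
    (hf : ∀ h t, f (tensorMulRight k V h t) = tensorMulRight k W h (f t))
    (hsurj : Function.Surjective f) : Function.Injective f := by
  let n := Module.finrank k V
  let eV : V ⊗[k] H ≃ₗ[k] (Fin n → H) :=
    (TensorProduct.equivFinsuppOfBasisLeft (Module.finBasis k V)).trans
      (Finsupp.linearEquivFunOnFinite k H (Fin n))
  let eW : W ⊗[k] H ≃ₗ[k] (Fin n → H) :=
    (TensorProduct.equivFinsuppOfBasisLeft (Module.finBasisOfFinrankEq k W hVW.symm)).trans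
      (Finsupp.linearEquivFunOnFinite k H (Fin n))
  have hV : ∀ h t i, eV (tensorMulRight k V h t) i = eV t i * h := fun h t i => by
    induction t with
    | zero => simp
    | add x y hx hy => rw [map_add, map_add, map_add, Pi.add_apply, Pi.add_apply, hx, hy, add_mul]
    | tmul v g => simp [eV, tensorMulRight]
  have hW : ∀ h t i, eW (tensorMulRight k W h t) i = eW t i * h := fun h t i => by
    induction t with
    | zero => simp
    | add x y hx hy => rw [map_add, map_add, map_add, Pi.add_apply, Pi.add_apply, hx, hy, add_mul]
    | tmul v g => simp [eW, tensorMulRight]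
  -- In coordinates `f` is right `H`-linear on `H^n`, that is, an endomorphism of a free left
  -- `Hᵐᵒᵖ`-module.
  let o : (Fin n → H) ≃+ (Fin n → Hᵐᵒᵖ) := AddEquiv.piCongrRight fun _ => MulOpposite.opAddEquiv
  let g : Module.End Hᵐᵒᵖ (Fin n → Hᵐᵒᵖ) :=
    { toFun := fun x => o (eW (f (eV.symm (o.symm x))))
      map_add' := fun x y => by simp only [map_add]
      map_smul' := fun c x => by
        have h1 : eV.symm (o.symm (c • x)) = tensorMulRight k V c.unop (eV.symm (o.symm x)) := by
          rw [LinearEquiv.symm_apply_eq]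
          funext i
          rw [hV, LinearEquiv.apply_symm_apply]
          rfl
        rw [h1, hf]
        funext i
        exact congrArg MulOpposite.op (hW c.unop _ i) }
  have hg : Function.Surjective g :=
    o.surjective.comp (eW.surjective.comp (hsurj.comp (eV.symm.surjective.comp o.symm.surjective)))
  have hgi := Module.End.injective_of_surjective_fin hg
  intro x y hxy
  have := @hgi (o (eV x)) (o (eV y)) (by simp [g, hxy])
  exact eV.injective (o.injective this)

end WeaklyFinite

/-! ### Coactions generating `M ⊗ H`, and costable ideals. -/

section Coaction

theorem tensorRightAction_map {k H A : Type*} [Field k] [Ring H]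
    [Algebra k H] [Ring A] [Algebra k A] {M N : Type*} [AddCommGroup M] [Module k M]
    [Module Aᵐᵒᵖ M] [IsScalarTower k Aᵐᵒᵖ M] [AddCommGroup N] [Module k N]
    [Module Aᵐᵒᵖ N] [IsScalarTower k Aᵐᵒᵖ N] (f : M →ₗ[Aᵐᵒᵖ] N) (t : M ⊗[k] H) (u : A ⊗[k] H) :
    (f.restrictScalars k).rTensor H (tensorRightAction k H A M t u) =
      tensorRightAction k H A N ((f.restrictScalars k).rTensor H t) u := by
  induction t with
  | zero => simp
  | add x y hx hy => simp only [map_add, LinearMap.add_apply, hx, hy]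
  | tmul m g =>
    induction u with
    | zero => simp
    | add x y hx hy => simp only [map_add, hx, hy]
    | tmul a h =>
      rw [tensorRightAction_tmul, LinearMap.rTensor_tmul, LinearMap.rTensor_tmul,
        tensorRightAction_tmul, LinearMap.restrictScalars_apply, map_smul]
      rfl

theorem tensorLeftAction_map {k H A : Type*} [Field k] [Ring H]
    [Algebra k H] [Ring A] [Algebra k A] {M N : Type*} [AddCommGroup M] [Module k M]
    [Module A M] [IsScalarTower k A M] [AddCommGroup N] [Module k N]
    [Module A N] [IsScalarTower k A N] (f : M →ₗ[A] N) (t : M ⊗[k] H) (u : A ⊗[k] H) :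
    (f.restrictScalars k).rTensor H (tensorLeftAction k H A M u t) =
      tensorLeftAction k H A N u ((f.restrictScalars k).rTensor H t) := by
  induction u with
  | zero => simp
  | add x y hx hy => simp only [map_add, LinearMap.add_apply, hx, hy]
  | tmul a h =>
    induction t with
    | zero => simp
    | add x y hx hy => simp only [map_add, hx, hy]
    | tmul m g =>
      rw [tensorLeftAction_tmul, LinearMap.rTensor_tmul, LinearMap.rTensor_tmul,
        tensorLeftAction_tmul, LinearMap.restrictScalars_apply, map_smul]
      rfl

/-- For a linear map `ρ : M → M ⊗ H`, the map `m ⊗ h ↦ ρ(m) h`. -/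
noncomputable def coactMul {k H M : Type*} [Field k] [Ring H] [Algebra k H] [AddCommGroup M]
    [Module k M] (ρ : M →ₗ[k] M ⊗[k] H) : M ⊗[k] H →ₗ[k] M ⊗[k] H :=
  (LinearMap.mul' k H).lTensor M ∘ₗ (TensorProduct.assoc k M H H).toLinearMap ∘ₗ ρ.rTensor H

theorem coactMul_tmul {k H M : Type*} [Field k] [Ring H] [Algebra k H] [AddCommGroup M]
    [Module k M] (ρ : M →ₗ[k] M ⊗[k] H) (m : M) (h : H) :
    coactMul ρ (m ⊗ₜ h) = tensorMulRight k M h (ρ m) := by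
  simp only [coactMul, LinearMap.comp_apply, LinearMap.rTensor_tmul, LinearEquiv.coe_coe]
  induction ρ m with
  | zero => simp
  | add x y hx hy => rw [TensorProduct.add_tmul, map_add, map_add, hx, hy, map_add]
  | tmul m g => simp

theorem coactMul_tensorMulRight {k H M : Type*} [Field k] [Ring H] [Algebra k H] [AddCommGroup M]
    [Module k M] (ρ : M →ₗ[k] M ⊗[k] H) (t : M ⊗[k] H) (h : H) :
    coactMul ρ (tensorMulRight k M h t) = tensorMulRight k M h (coactMul ρ t) := by
  induction t with
  | zero => simp
  | add x y hx hy => simp only [map_add, hx, hy]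
  | tmul m g =>
    rw [LinearMap.lTensor_tmul, coactMul_tmul, coactMul_tmul, LinearMap.mulRight_apply]
    induction ρ m with
    | zero => simp
    | add x y hx hy => simp only [map_add, hx, hy]
    | tmul m x => simp [mul_assoc]

theorem coactMul_map {k H M N : Type*} [Field k] [Ring H] [Algebra k H] [AddCommGroup M]
    [Module k M] [AddCommGroup N] [Module k N] {ρ : M →ₗ[k] M ⊗[k] H} {σ : N →ₗ[k] N ⊗[k] H}
    (f : M →ₗ[k] N) (hf : ∀ m, σ (f m) = f.rTensor H (ρ m)) (t : M ⊗[k] H) :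
    coactMul σ (f.rTensor H t) = f.rTensor H (coactMul ρ t) := by
  induction t with
  | zero => simp
  | add x y hx hy => simp only [map_add, hx, hy]
  | tmul m g =>
    rw [LinearMap.rTensor_tmul, coactMul_tmul, coactMul_tmul, hf]
    induction ρ m with
    | zero => simp
    | add x y hx hy => simp only [map_add, hx, hy]
    | tmul m x => simp

variable {k H A : Type*} [Field k] [Ring H] [Bialgebra k H] [Ring A] [Algebra k A] [RightComoduleAlgebra k H A]

/-- A linear map `ρ : M → M ⊗ H` on a right `A`-module which is compatible with the coaction of
`A` and whose image generates the right `H`-module `M ⊗ H`. -/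
structure IsGeneratingCoaction (k H A : Type*) [Field k] [Ring H] [Bialgebra k H] [Ring A]
    [Algebra k A] [RightComoduleAlgebra k H A] {M : Type*} [AddCommGroup M] [Module k M]
    [Module Aᵐᵒᵖ M] [IsScalarTower k Aᵐᵒᵖ M] (ρ : M →ₗ[k] M ⊗[k] H) : Prop where
  coact_smul : ∀ (m : M) (a : A), ρ (MulOpposite.op a • m) =
    tensorRightAction k H A M (ρ m) (RightComodule.coact k H A a)
  exists_eq : ∀ m : M, ∃ t, coactMul ρ t = m ⊗ₜ[k] (1 : H)

theorem IsGeneratingCoaction.coactMul_surjective {M : Type*} [AddCommGroup M] [Module k M]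
    [Module Aᵐᵒᵖ M] [IsScalarTower k Aᵐᵒᵖ M] {ρ : M →ₗ[k] M ⊗[k] H}
    (hρ : IsGeneratingCoaction k H A ρ) : Function.Surjective (coactMul ρ) := by
  intro t
  induction t with
  | zero => exact ⟨0, map_zero _⟩
  | add x y hx hy =>
    obtain ⟨x, rfl⟩ := hx
    obtain ⟨y, rfl⟩ := hy
    exact ⟨x + y, map_add _ _ _⟩
  | tmul m h =>
    obtain ⟨t, ht⟩ := hρ.exists_eq m
    exact ⟨tensorMulRight k M h t, by rw [coactMul_tensorMulRight, ht]; simp⟩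

/-- The rank argument is run on a power of `M`, with the coaction taken componentwise. -/
theorem IsGeneratingCoaction.pi {M : Type*} [AddCommGroup M] [Module k M]
    [Module Aᵐᵒᵖ M] [IsScalarTower k Aᵐᵒᵖ M] {ρ : M →ₗ[k] M ⊗[k] H}
    (hρ : IsGeneratingCoaction k H A ρ) (l : ℕ) :
    ∃ σ : (Fin l → M) →ₗ[k] (Fin l → M) ⊗[k] H, IsGeneratingCoaction k H A σ := by
  let σ : (Fin l → M) →ₗ[k] (Fin l → M) ⊗[k] H := ∑ i,
    ((LinearMap.single Aᵐᵒᵖ (fun _ => M) i).restrictScalars k).rTensor H ∘ₗ ρ ∘ₗ LinearMap.proj i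
  have hσ : ∀ x, σ x = ∑ i,
      ((LinearMap.single Aᵐᵒᵖ (fun _ => M) i).restrictScalars k).rTensor H (ρ (x i)) := fun x => by
    simp [σ]
  have hσs : ∀ i m, σ (((LinearMap.single Aᵐᵒᵖ (fun _ => M) i).restrictScalars k) m) =
      ((LinearMap.single Aᵐᵒᵖ (fun _ => M) i).restrictScalars k).rTensor H (ρ m) := fun i m => by
    rw [hσ, Finset.sum_eq_single i]
    · simp
    · intro j _ hj
      simp [hj]
    · simp
  refine ⟨σ, ⟨fun x a => ?_, fun x => ?_⟩⟩
  · rw [hσ, hσ, map_sum, LinearMap.sum_apply]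
    refine Finset.sum_congr rfl fun i _ => ?_
    rw [← tensorRightAction_map, ← hρ.coact_smul, Pi.smul_apply]
  · choose t ht using fun i => hρ.exists_eq (x i)
    refine ⟨∑ i, ((LinearMap.single Aᵐᵒᵖ (fun _ => M) i).restrictScalars k).rTensor H (t i), ?_⟩
    rw [map_sum]
    have : ∀ i, coactMul σ
        (((LinearMap.single Aᵐᵒᵖ (fun _ => M) i).restrictScalars k).rTensor H (t i)) =
        Pi.single i (x i) ⊗ₜ[k] (1 : H) := fun i => by
      rw [coactMul_map _ (hσs i), ht]
      simp
    rw [Finset.sum_congr rfl fun i _ => this i, ← TensorProduct.sum_tmul, Finset.univ_sum_single]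

/-- In an `H`-simple algebra, the largest costable ideal inside a proper ideal `Q`, which is
`{a | ρ(a) ∈ Q ⊗ H}`, is zero. -/
theorem IsHSimple.eq_zero_of_coact_mem (hA : IsHSimple k H A) {Q : TwoSidedIdeal A}
    (hQ : Q ≠ ⊤) {a : A} (ha : RightComodule.coact k H A a ∈
      LinearMap.range ((Q.asIdeal.restrictScalars k).subtype.rTensor H)) : a = 0 := by
  set T := LinearMap.range ((Q.asIdeal.restrictScalars k).subtype.rTensor H) with hT
  have hleft : ∀ u : A ⊗[k] H, ∀ t ∈ T, u * t ∈ T := by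
    rintro u _ ⟨s, rfl⟩
    induction s with
    | zero => simp
    | add x y hx hy => rw [map_add, mul_add]; exact T.add_mem hx hy
    | tmul q h =>
      induction u with
      | zero => simp
      | add x y hx hy => rw [add_mul]; exact T.add_mem hx hy
      | tmul b g =>
        exact ⟨(⟨b * q, Q.mul_mem_left _ _ q.2⟩ : Q.asIdeal.restrictScalars k) ⊗ₜ (g * h), by simp⟩
  have hright : ∀ u : A ⊗[k] H, ∀ t ∈ T, t * u ∈ T := by
    rintro u _ ⟨s, rfl⟩
    induction s with
    | zero => simp
    | add x y hx hy => rw [map_add, add_mul]; exact T.add_mem hx hy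
    | tmul q h =>
      induction u with
      | zero => simp
      | add x y hx hy => rw [mul_add]; exact T.add_mem hx hy
      | tmul b g =>
        exact ⟨(⟨q * b, Q.mul_mem_right _ _ q.2⟩ : Q.asIdeal.restrictScalars k) ⊗ₜ (h * g), by simp⟩
  let I : TwoSidedIdeal A := TwoSidedIdeal.mk' {a | RightComodule.coact k H A a ∈ T}
    (by simp) (fun hx hy => by simpa using T.add_mem hx hy) (fun hx => by simpa using hx)
    (fun {x y} hy => by
      simp only [Set.mem_ofPred_eq, RightComoduleAlgebra.coact_mul]; exact hleft _ _ hy)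
    (fun {x y} hx => by
      simp only [Set.mem_ofPred_eq, RightComoduleAlgebra.coact_mul]; exact hright _ _ hx)
  have hI : ∀ x, x ∈ I ↔ RightComodule.coact k H A x ∈ T := fun x => TwoSidedIdeal.mem_mk' ..
  -- The counit recovers `x` from `ρ(x) ∈ Q ⊗ H`.
  have hIQ : I ≤ Q := fun x hx => by
    obtain ⟨s, hs⟩ := (hI x).1 hx
    have h1 := LinearMap.congr_fun (RightComodule.counital (k := k) (H := H) (M := A)) x
    simp only [LinearMap.comp_apply, LinearEquiv.coe_coe, LinearMap.id_apply] at h1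
    rw [← h1, ← hs]
    clear h1 hs
    induction s with
    | zero => simp
    | add x y hx hy => simp only [map_add]; exact Q.add_mem hx hy
    | tmul q h =>
      simpa using (Q.asIdeal.restrictScalars k).smul_mem (Coalgebra.counit (R := k) h) q.2
  have hcost : IsCostable k H I := by
    let q := (Q.asIdeal.restrictScalars k).mkQ
    have hq : Function.Exact ((Q.asIdeal.restrictScalars k).subtype.rTensor H) (q.rTensor H) :=
      Module.Flat.rTensor_exact H (LinearMap.exact_subtype_mkQ _)
    -- `I` is the kernel of `g`, so by flatness `I ⊗ H` is the kernel of `g ⊗ id`. By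
    -- coassociativity `(g ⊗ id) ρ = (id ⊗ Δ) g` up to reassociation, which vanishes on `I`.
    let g : A →ₗ[k] _ := q.rTensor H ∘ₗ RightComodule.coact k H A
    have hg : ∀ x, x ∈ I ↔ g x = 0 := fun x => (hI x).trans (hq _).symm
    have hIg : Function.Exact (I.asIdeal.restrictScalars k).subtype g := fun x => by
      rw [← hg]
      simp
    intro x hx
    refine (Module.Flat.rTensor_exact H hIg _).1 ?_
    have h1 := LinearMap.congr_fun (RightComodule.coassoc (k := k) (H := H) (M := A)) x
    simp only [LinearMap.comp_apply, LinearEquiv.coe_coe] at h1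
    rw [← LinearEquiv.eq_symm_apply] at h1
    rw [LinearMap.rTensor_comp, LinearMap.comp_apply, h1]
    have h2 : ∀ t : A ⊗[k] H, (q.rTensor H).rTensor H ((TensorProduct.assoc k A H H).symm
        ((Coalgebra.comul (R := k) (A := H)).lTensor A t)) = (TensorProduct.assoc k _ H H).symm
        ((Coalgebra.comul (R := k) (A := H)).lTensor _ (q.rTensor H t)) := fun t => by
      induction t with
      | zero => simp
      | add x y hx hy => simp only [map_add, hx, hy]
      | tmul a h =>
        simp only [LinearMap.lTensor_tmul, LinearMap.rTensor_tmul]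
        induction (Coalgebra.comul (R := k) h) with
        | zero => simp
        | add x y hx hy => simp only [TensorProduct.tmul_add, map_add, hx, hy]
        | tmul x y => simp
    rw [h2, show q.rTensor H (RightComodule.coact k H A x) = 0 from (hg x).1 hx]
    simp
  rcases hA.2 I hcost with h | h
  · rw [← TwoSidedIdeal.mem_bot A, ← h]
    exact (hI a).2 ha
  · exact absurd (top_le_iff.1 (h ▸ hIQ)) hQ

end Coaction

/-! ### The main argument: free powers from a generating coaction. -/

section GeneratingCoaction

variable {k H A : Type*} [Field k] [Ring H] [Bialgebra k H] [Ring A] [Algebra k A]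
  [RightComoduleAlgebra k H A]

/-- The projection `A → Aᵐᵒᵖ / P`. -/
noncomputable def opQuotientMk (k : Type*) {A : Type*} [Field k] [Ring A] [Algebra k A]
    (P : TwoSidedIdeal Aᵐᵒᵖ) : A →ₗ[k] Aᵐᵒᵖ ⧸ P.asIdeal :=
  (Ideal.Quotient.mkₐ k P.asIdeal).toLinearMap ∘ₗ (MulOpposite.opLinearEquiv k).toLinearMap

theorem IsHSimple.eq_zero_of_opQuotientMk (hA : IsHSimple k H A) {P : TwoSidedIdeal Aᵐᵒᵖ}
    (hP : IsCoatom P) {a : A}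
    (ha : (opQuotientMk k P).rTensor H (RightComodule.coact k H A a) = 0) : a = 0 := by
  have hQ : P.unop ≠ ⊤ := fun h => hP.1 (by
    rw [← TwoSidedIdeal.one_mem_iff]
    have : (1 : A) ∈ P.unop := h ▸ trivial
    exact TwoSidedIdeal.mem_unop_iff.1 this)
  refine hA.eq_zero_of_coact_mem hQ ?_
  have hex : Function.Exact ((P.unop.asIdeal.restrictScalars k).subtype) (opQuotientMk k P) :=
    fun x => by
      have : opQuotientMk k P x = 0 ↔ MulOpposite.op x ∈ P.asIdeal :=
        Ideal.Quotient.eq_zero_iff_mem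
      rw [this]
      simp [TwoSidedIdeal.mem_unop_iff]
  exact (Module.Flat.rTensor_exact H hex _).1 ha

variable {M : Type*} [AddCommGroup M] [Module k M] [Module Aᵐᵒᵖ M] [IsScalarTower k Aᵐᵒᵖ M]
  [FiniteDimensional k A] [Module.Finite k M]

/-- Twisting `f` by the coaction gives an `H`-linear map `θ` between free `H`-modules of equal rank.
It is onto because the coaction generates, hence injective, and `H`-simplicity carries injectivity
back to `f`. -/
theorem IsGeneratingCoaction.injective_of_surjective (hA : IsHSimple k H A)
    (hH : IsStablyFiniteRing H) {ρ : M →ₗ[k] M ⊗[k] H} (hρ : IsGeneratingCoaction k H A ρ)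
    {P : TwoSidedIdeal Aᵐᵒᵖ} (hP : IsCoatom P) {n : ℕ} (f : (Fin n → Aᵐᵒᵖ) →ₗ[Aᵐᵒᵖ] M)
    (hf : Function.Surjective f)
    (hn : Module.finrank k (M ⧸ (P.asIdeal • ⊤ : Submodule Aᵐᵒᵖ M)) =
      n * Module.finrank k (Aᵐᵒᵖ ⧸ P.asIdeal)) : Function.Injective f := by
  let W := M ⧸ (P.asIdeal • ⊤ : Submodule Aᵐᵒᵖ M)
  let B := Aᵐᵒᵖ ⧸ P.asIdeal
  have : Module.Finite k B := Module.Finite.of_surjective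
    (Ideal.Quotient.mkₐ k P.asIdeal).toLinearMap Ideal.Quotient.mk_surjective
  let p : M →ₗ[k] W := (P.asIdeal • ⊤ : Submodule Aᵐᵒᵖ M).mkQ.restrictScalars k
  have hp : Function.Surjective p := Submodule.mkQ_surjective (P.asIdeal • ⊤ : Submodule Aᵐᵒᵖ M)
  have : Module.Finite k W := Module.Finite.of_surjective p hp
  let μ : M →ₗ[k] B →ₗ[k] W := (Algebra.lsmul k k W).toLinearMap.flip ∘ₗ p
  let act : M ⊗[k] H →ₗ[k] B ⊗[k] H →ₗ[k] W ⊗[k] H := TensorProduct.map₂ μ (LinearMap.mul k H)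
  have hact : ∀ t u, act t ((opQuotientMk k P).rTensor H u) =
      p.rTensor H (tensorRightAction k H A M t u) := fun t u => by
    induction t with
    | zero => simp
    | add x y hx hy => simp only [map_add, LinearMap.add_apply, hx, hy]
    | tmul m g =>
      induction u with
      | zero => simp
      | add x y hx hy => simp only [map_add, hx, hy]
      | tmul a h => rfl
  have hactH : ∀ t u h, act t (tensorMulRight k B h u) = tensorMulRight k W h (act t u) :=
    fun t u h => by
    induction t with
    | zero => simp
    | add x y hx hy => simp only [map_add, LinearMap.add_apply, hx, hy]
    | tmul m g =>
      induction u with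
      | zero => simp
      | add x y hx hy => simp only [map_add, hx, hy]
      | tmul a h' => simp [act, mul_assoc]
  let V := Fin n → B
  -- `θ` sends the `j`-th basis vector to the reduction of `ρ (f e_j)`; the action `act` of `B ⊗ H`
  -- is well defined because it takes values modulo `P`.
  let θ : V ⊗[k] H →ₗ[k] W ⊗[k] H := ∑ j,
    act (ρ (f (Pi.single j 1))) ∘ₗ (LinearMap.proj (R := k) (φ := fun _ : Fin n => B) j).rTensor H
  have hθ : ∀ t, θ t = ∑ j, act (ρ (f (Pi.single j 1)))
      ((LinearMap.proj (R := k) (φ := fun _ : Fin n => B) j).rTensor H t) := fun t => by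
    simp [θ]
  have hθH : ∀ h t, θ (tensorMulRight k V h t) = tensorMulRight k W h (θ t) := fun h t => by
    rw [hθ, hθ, map_sum]
    refine Finset.sum_congr rfl fun j _ => ?_
    rw [← hactH]
    congr 1
    induction t with
    | zero => simp
    | add x y hx hy => simp only [map_add, hx, hy]
    | tmul v g => simp
  -- `X x` is the reduction modulo `P` of the coordinatewise coaction of `x`, chosen so that `θ (X
  -- x)` is the reduction of `ρ (f x)`.
  let X : (Fin n → Aᵐᵒᵖ) → V ⊗[k] H := fun x => ∑ j,
    (LinearMap.single k (fun _ : Fin n => B) j).rTensor H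
      ((opQuotientMk k P).rTensor H (RightComodule.coact k H A (x j).unop))
  have hX : ∀ x j, (LinearMap.proj (R := k) (φ := fun _ : Fin n => B) j).rTensor H (X x) =
      (opQuotientMk k P).rTensor H (RightComodule.coact k H A (x j).unop) := fun x j => by
    simp only [X, map_sum]
    rw [Finset.sum_eq_single j]
    · rw [← LinearMap.comp_apply, ← LinearMap.rTensor_comp, LinearMap.proj_comp_single_same,
        LinearMap.rTensor_id, LinearMap.id_apply]
    · intro i _ hij
      rw [← LinearMap.comp_apply, ← LinearMap.rTensor_comp, LinearMap.proj_comp_single_ne _ _ _ _ hij.symm,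
        LinearMap.rTensor_zero, LinearMap.zero_apply]
    · simp
  have hθX : ∀ x, θ (X x) = p.rTensor H (ρ (f x)) := fun x => by
    have hx : f x = ∑ j, x j • f (Pi.single j 1) := by
      conv_lhs => rw [← Finset.univ_sum_single x]
      rw [map_sum]
      refine Finset.sum_congr rfl fun j _ => ?_
      rw [← map_smul, ← Pi.single_smul, smul_eq_mul, mul_one]
    rw [hθ, hx, map_sum, map_sum]
    refine Finset.sum_congr rfl fun j _ => ?_
    rw [hX, hact, ← hρ.coact_smul, MulOpposite.op_unop]
  have hsurj : Function.Surjective θ := by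
    rw [← LinearMap.range_eq_top, eq_top_iff]
    rintro t -
    obtain ⟨t, rfl⟩ := LinearMap.rTensor_surjective H hp t
    obtain ⟨t, rfl⟩ := hρ.coactMul_surjective t
    induction t with
    | zero => simp
    | add x y hx hy => simp only [map_add]; exact Submodule.add_mem _ hx hy
    | tmul m h =>
      obtain ⟨x, rfl⟩ := hf m
      refine ⟨tensorMulRight k V h (X x), ?_⟩
      rw [hθH, hθX, coactMul_tmul]
      induction ρ (f x) with
      | zero => simp
      | add x y hx hy => simp only [map_add, hx, hy]
      | tmul m g => simp
  have hinj := hH.injective_of_surjective_tensor (k := k) (by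
    rw [hn, Module.finrank_pi_fintype]
    simp [B]) θ hθH hsurj
  rw [injective_iff_map_eq_zero]
  intro x hx
  have hX0 : X x = 0 := hinj (by rw [hθX, hx]; simp)
  funext j
  have := hX x j
  rw [hX0, map_zero] at this
  exact MulOpposite.unop_injective (hA.eq_zero_of_opQuotientMk hP this.symm)

/-- At a `P` of maximal rank `n / l`, the power `M^l` has rank exactly `n`, and at most `n` at every
other maximal ideal. So a surjection from the free module of rank `n` exists, and it is injective by
the preceding lemma. -/
theorem IsGeneratingCoaction.hasFreePower (hA : IsHSimple k H A)
    (hH : IsStablyFiniteRing H) {ρ : M →ₗ[k] M ⊗[k] H} (hρ : IsGeneratingCoaction k H A ρ) :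
    HasFreePower Aᵐᵒᵖ M := by
  have := hA.1
  have : IsNoetherianRing Aᵐᵒᵖ := IsNoetherianRing.of_finite k Aᵐᵒᵖ
  obtain ⟨Q, hQ, -⟩ := TwoSidedIdeal.exists_coatom_ge
    (bot_ne_top : (⊥ : TwoSidedIdeal Aᵐᵒᵖ) ≠ ⊤)
  obtain ⟨P, hP, hmax⟩ := Set.exists_max_image {P : TwoSidedIdeal Aᵐᵒᵖ | IsCoatom P}
    (fun P => (Module.finrank k (M ⧸ (P.asIdeal • ⊤ : Submodule Aᵐᵒᵖ M)) : ℚ) /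
      Module.finrank k (Aᵐᵒᵖ ⧸ P.asIdeal)) (TwoSidedIdeal.finite_setOf_isCoatom k Aᵐᵒᵖ) ⟨Q, hQ⟩
  have hpos := fun {P : TwoSidedIdeal Aᵐᵒᵖ} (hP : IsCoatom P) =>
    TwoSidedIdeal.finrank_quotient_pos k hP
  set l := Module.finrank k (Aᵐᵒᵖ ⧸ P.asIdeal)
  set n := Module.finrank k (M ⧸ (P.asIdeal • ⊤ : Submodule Aᵐᵒᵖ M))
  obtain ⟨f, hf, -⟩ := exists_linearMap_surjective_of_rank_le (R := Aᵐᵒᵖ) (M := Fin l → M) k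
    (ι := Fin n) fun P' hP' => by
      have h1 := hmax P' hP'
      rw [div_le_div_iff₀ (by exact_mod_cast hpos hP') (by exact_mod_cast hpos hP)] at h1
      have h2 : l * Module.finrank k (M ⧸ (P'.asIdeal • ⊤ : Submodule Aᵐᵒᵖ M)) ≤
          n * Module.finrank k (Aᵐᵒᵖ ⧸ P'.asIdeal) := by
        rw [mul_comm]; exact_mod_cast h1
      have : FiniteDimensional k (Aᵐᵒᵖ ⧸ P'.asIdeal) := Module.Finite.of_surjective
        (Ideal.Quotient.mkₐ k P'.asIdeal).toLinearMap Ideal.Quotient.mk_surjective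
      rw [rank_finsupp, ← Module.finrank_eq_rank,
        ← Module.finrank_eq_rank k (Aᵐᵒᵖ ⧸ P'.asIdeal), finrank_quotient_smul_top_pi k]
      simp only [Cardinal.lift_natCast, Cardinal.mk_fin, Cardinal.lift_mul]
      exact_mod_cast h2
  let g := f ∘ₗ (Finsupp.linearEquivFunOnFinite Aᵐᵒᵖ Aᵐᵒᵖ (Fin n)).symm.toLinearMap
  have hg : Function.Surjective g := hf.comp (LinearEquiv.surjective _)
  obtain ⟨σ, hσ⟩ := hρ.pi l
  have hgi := hσ.injective_of_surjective hA hH hP g hg (by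
    rw [finrank_quotient_smul_top_pi k, mul_comm])
  exact ⟨l, n, hpos hP, ⟨(LinearEquiv.ofBijective g ⟨hgi, hg⟩).symm⟩⟩

end GeneratingCoaction

/-! ### Slices of tensors by functionals on `H`. -/

section Slices

variable {k H M : Type*} [Field k] [AddCommGroup H] [Module k H] [AddCommGroup M] [Module k M]

/-- Contraction of the right tensor factor with a functional. -/
noncomputable def tensorSlice (M : Type*) [AddCommGroup M] [Module k M] (f : Module.Dual k H) :
    M ⊗[k] H →ₗ[k] M :=
  (TensorProduct.rid k M).toLinearMap ∘ₗ f.lTensor M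

@[simp]
theorem tensorSlice_tmul (f : Module.Dual k H) (m : M) (h : H) :
    tensorSlice M f (m ⊗ₜ h) = f h • m := by
  simp [tensorSlice]

theorem tensorSlice_map {N : Type*} [AddCommGroup N] [Module k N] (f : Module.Dual k H)
    (g : M →ₗ[k] N) (t : M ⊗[k] H) : tensorSlice N f (g.rTensor H t) = g (tensorSlice M f t) := by
  induction t with
  | zero => simp
  | add x y hx hy => simp only [map_add, hx, hy]
  | tmul m h => simp

theorem tensorSlice_lTensor {H' : Type*} [AddCommGroup H'] [Module k H'] (f : Module.Dual k H')
    (g : H →ₗ[k] H') (t : M ⊗[k] H) :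
    tensorSlice M f (g.lTensor M t) = tensorSlice M (f ∘ₗ g) t := by
  induction t with
  | zero => simp
  | add x y hx hy => simp only [map_add, hx, hy]
  | tmul m h => simp

theorem eq_zero_of_forall_tensorSlice {t : M ⊗[k] H}
    (h : ∀ f : Module.Dual k H, tensorSlice M f t = 0) : t = 0 := by
  let b := Module.Free.chooseBasis k H
  apply (TensorProduct.equivFinsuppOfBasisRight b (M := M)).injective
  rw [map_zero]
  ext i
  rw [Finsupp.zero_apply, ← h (b.coord i)]
  clear h
  induction t with
  | zero => simp
  | add x y hx hy => simp only [map_add, Finsupp.add_apply, hx, hy]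
  | tmul m h => simp

theorem mem_range_rTensor_of_forall_tensorSlice {N : Submodule k M} {t : M ⊗[k] H}
    (h : ∀ f : Module.Dual k H, tensorSlice M f t ∈ N) :
    t ∈ LinearMap.range (N.subtype.rTensor H) := by
  refine (Module.Flat.rTensor_exact H (LinearMap.exact_subtype_mkQ N) t).1 ?_
  refine eq_zero_of_forall_tensorSlice fun f => ?_
  rw [tensorSlice_map]
  exact (Submodule.Quotient.mk_eq_zero N).2 (h f)

theorem exists_finite_forall_tensorSlice_mem (t : M ⊗[k] H) :
    ∃ W : Submodule k M, W.FG ∧ ∀ f : Module.Dual k H, tensorSlice M f t ∈ W := by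
  induction t with
  | zero => exact ⟨⊥, Submodule.fg_bot, fun f => by simp⟩
  | add x y hx hy =>
    obtain ⟨W, hW, hx⟩ := hx
    obtain ⟨W', hW', hy⟩ := hy
    refine ⟨W ⊔ W', hW.sup hW', fun f => ?_⟩
    rw [map_add]
    exact Submodule.add_mem_sup (hx f) (hy f)
  | tmul m h =>
    exact ⟨k ∙ m, Submodule.fg_span_singleton m, fun f => by
      rw [tensorSlice_tmul]; exact Submodule.smul_mem _ _ (Submodule.mem_span_singleton_self m)⟩

/-- The functional `f ∘ ρ`-slice form of coassociativity. -/
theorem tensorSlice_coact_tensorSlice [Coalgebra k H] [RightComodule k H M]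
    (f g : Module.Dual k H) (m : M) :
    tensorSlice M g (RightComodule.coact k H M
      (tensorSlice M f (RightComodule.coact k H M m))) =
      tensorSlice M ((LinearMap.mul' k k ∘ₗ TensorProduct.map g f) ∘ₗ Coalgebra.comul)
        (RightComodule.coact k H M m) := by
  have h1 := LinearMap.congr_fun (RightComodule.coassoc (k := k) (H := H) (M := M)) m
  simp only [LinearMap.comp_apply, LinearEquiv.coe_coe] at h1
  rw [← tensorSlice_lTensor, ← h1]
  induction RightComodule.coact k H M m with
  | zero => simp
  | add x y hx hy => simp only [map_add, hx, hy]
  | tmul m h =>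
    rw [tensorSlice_tmul, map_smul, map_smul, LinearMap.rTensor_tmul]
    induction RightComodule.coact k H M m with
    | zero => simp
    | add x y hx hy => simp only [map_add, smul_add, hx, hy, TensorProduct.add_tmul]
    | tmul m h' => simp [smul_smul, mul_comm]

theorem tensorSlice_counit_coact [Coalgebra k H] [RightComodule k H M] (m : M) :
    tensorSlice M Coalgebra.counit (RightComodule.coact k H M m) = m :=
  LinearMap.congr_fun (RightComodule.counital (k := k) (H := H) (M := M)) m

end Slices

/-! ### Local finiteness and coactions on stable submodules. -/

section Stable

variable {k H R M : Type*} [Field k] [AddCommGroup H] [Module k H] [Coalgebra k H] [Ring R]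
  [AddCommGroup M] [Module k M] [Module R M]

/-- The submodules of `M` which are stable under all slices of the coaction. -/
def stableSubmodules (k H R M : Type*) [Field k] [AddCommGroup H] [Module k H] [Coalgebra k H]
    [Ring R] [AddCommGroup M] [Module k M] [Module R M] [RightComodule k H M] :
    Set (Submodule R M) :=
  {N | ∀ f : Module.Dual k H, ∀ m ∈ N, tensorSlice M f (RightComodule.coact k H M m) ∈ N}

variable [RightComodule k H M]

theorem sSup_mem_stableSubmodules {T : Set (Submodule R M)} (hT : T ⊆ stableSubmodules k H R M) :
    sSup T ∈ stableSubmodules k H R M := by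
  intro f m hm
  rw [sSup_eq_iSup'] at hm
  refine Submodule.iSup_induction (fun N : T => N.1)
    (motive := fun m => tensorSlice M f (RightComodule.coact k H M m) ∈ sSup T) hm
    (fun N x hx => le_sSup N.2 (hT N.2 f x hx)) ?_ fun x y hx hy => ?_
  · rw [map_zero, map_zero]; exact Submodule.zero_mem _
  · rw [map_add, map_add]; exact Submodule.add_mem _ hx hy

variable [Algebra k R] [IsScalarTower k R M]

/-- The slices of `ρ(x)` span a finite-dimensional space, which contains `x` by the counit and is
stable by coassociativity; the `R`-submodule it generates is stable by `hsmul`. -/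
theorem exists_finite_mem_stableSubmodules
    (hsmul : ∀ (r : R) (m : M) (N : Submodule R M),
      (∀ f : Module.Dual k H, tensorSlice M f (RightComodule.coact k H M m) ∈ N) →
      ∀ f : Module.Dual k H, tensorSlice M f (RightComodule.coact k H M (r • m)) ∈ N) (x : M) :
    ∃ N ∈ stableSubmodules k H R M, x ∈ N ∧ Module.Finite R N := by
  let V := Submodule.span k
    (Set.range fun f : Module.Dual k H => tensorSlice M f (RightComodule.coact k H M x))
  have hV : ∀ f : Module.Dual k H, tensorSlice M f (RightComodule.coact k H M x) ∈ V :=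
    fun f => Submodule.subset_span ⟨f, rfl⟩
  have hVfg : V.FG := by
    obtain ⟨W, hW, hWx⟩ := exists_finite_forall_tensorSlice_mem (RightComodule.coact k H M x)
    have : Module.Finite k W := Module.Finite.iff_fg.2 hW
    have hVW : V ≤ W := Submodule.span_le.2 (by rintro _ ⟨f, rfl⟩; exact hWx f)
    have := Module.Finite.of_injective (Submodule.inclusion hVW) (Submodule.inclusion_injective _)
    exact Module.Finite.iff_fg.1 this
  refine ⟨Submodule.span R V, ?_, ?_, ?_⟩
  · intro f m hm
    revert f
    induction hm using Submodule.span_induction with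
    | mem y hy =>
      induction hy using Submodule.span_induction with
      | mem y hy =>
        obtain ⟨g, rfl⟩ := hy
        intro f
        rw [tensorSlice_coact_tensorSlice]
        exact Submodule.subset_span (hV _)
      | zero => simp
      | add y z _ _ hy hz =>
        intro f
        rw [map_add, map_add]
        exact Submodule.add_mem _ (hy f) (hz f)
      | smul c y _ hy =>
        intro f
        rw [map_smul, map_smul]
        exact Submodule.smul_of_tower_mem _ c (hy f)
    | zero => simp
    | add y z _ _ hy hz =>
      intro f
      rw [map_add, map_add]
      exact Submodule.add_mem _ (hy f) (hz f)
    | smul r y _ hy => exact hsmul r y _ hy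
  · refine Submodule.subset_span ?_
    have := hV Coalgebra.counit
    rwa [tensorSlice_counit_coact] at this
  · obtain ⟨s, hs⟩ := hVfg
    rw [← hs, Submodule.span_span_of_tower]
    exact Module.Finite.iff_fg.2 ⟨s, rfl⟩

/-- The coaction on a stable submodule. -/
theorem exists_rightComodule_of_mem_stableSubmodules {N : Submodule R M}
    (hN : N ∈ stableSubmodules k H R M) :
    ∃ C : RightComodule k H N, ∀ n : N, (N.subtype.restrictScalars k).rTensor H (C.coact n) =
      RightComodule.coact k H M (n : M) := by
  let i : N →ₗ[k] M := N.subtype.restrictScalars k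
  have hi : Function.Injective (i.rTensor H) :=
    Module.Flat.rTensor_preserves_injective_linearMap i N.injective_subtype
  let e := LinearEquiv.ofInjective (i.rTensor H) hi
  let c : N →ₗ[k] N ⊗[k] H := e.symm.toLinearMap ∘ₗ
    (RightComodule.coact k H M ∘ₗ i).codRestrict (LinearMap.range (i.rTensor H)) fun n =>
      mem_range_rTensor_of_forall_tensorSlice (N := N.restrictScalars k) fun f => hN f n n.2
  have hc : ∀ n, i.rTensor H (c n) = RightComodule.coact k H M (i n) := fun n =>
    congrArg Subtype.val (e.apply_symm_apply _)
  have hi2 : Function.Injective (i.rTensor (H ⊗[k] H)) :=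
    Module.Flat.rTensor_preserves_injective_linearMap i N.injective_subtype
  refine ⟨⟨c, ?_, ?_⟩, hc⟩
  · ext n
    apply hi2
    have h1 := LinearMap.congr_fun (RightComodule.coassoc (k := k) (H := H) (M := M)) (i n)
    simp only [LinearMap.comp_apply, LinearEquiv.coe_coe] at h1 ⊢
    have h2 : ∀ t : N ⊗[k] H, i.rTensor (H ⊗[k] H) (TensorProduct.assoc k N H H (c.rTensor H t)) =
        TensorProduct.assoc k M H H ((RightComodule.coact k H M).rTensor H (i.rTensor H t)) :=
      fun t => by
      induction t with
      | zero => simp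
      | add x y hx hy => simp only [map_add, hx, hy]
      | tmul n h =>
        simp only [LinearMap.rTensor_tmul]
        rw [← hc]
        induction c n with
        | zero => simp
        | add x y hx hy => simp only [map_add, TensorProduct.add_tmul, hx, hy]
        | tmul m h' => simp
    have h3 : ∀ t : N ⊗[k] H, i.rTensor (H ⊗[k] H) ((Coalgebra.comul (R := k)).lTensor N t) =
        (Coalgebra.comul (R := k)).lTensor M (i.rTensor H t) := fun t => by
      rw [← LinearMap.comp_apply, ← LinearMap.comp_apply, LinearMap.rTensor_comp_lTensor,
        LinearMap.lTensor_comp_rTensor]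
    rw [h2, h3, hc, h1]
  · ext n
    have h1 := tensorSlice_map (Coalgebra.counit (R := k) (A := H)) i (c n)
    rw [hc, tensorSlice_counit_coact] at h1
    exact h1.symm

end Stable

/-! ### Hopf modules: generation via the antipode, and the family of Hopf submodules. -/

section Comodule

theorem tensorSlice_tensorRightAction_mem {k H A M : Type*} [Field k] [Ring H] [Algebra k H]
    [Ring A] [Algebra k A] [AddCommGroup M] [Module k M] [Module Aᵐᵒᵖ M] [IsScalarTower k Aᵐᵒᵖ M]
    {N : Submodule Aᵐᵒᵖ M} {t : M ⊗[k] H} (ht : ∀ f : Module.Dual k H, tensorSlice M f t ∈ N)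
    (u : A ⊗[k] H) (f : Module.Dual k H) :
    tensorSlice M f (tensorRightAction k H A M t u) ∈ N := by
  induction u with
  | zero => simp
  | add x y hx hy => simp only [map_add]; exact N.add_mem hx hy
  | tmul a h =>
    have : tensorSlice M f (tensorRightAction k H A M t (a ⊗ₜ h)) =
        MulOpposite.op a • tensorSlice M (f ∘ₗ LinearMap.mulRight k h) t := by
      clear ht
      induction t with
      | zero => simp
      | add x y hx hy => simp only [map_add, LinearMap.add_apply, smul_add, hx, hy]
      | tmul m g =>
        simp only [tensorRightAction_tmul, tensorSlice_tmul, LinearMap.comp_apply,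
          LinearMap.mulRight_apply]
        exact smul_comm _ _ _
    rw [this]
    exact N.smul_mem _ (ht _)

theorem tensorSlice_tensorLeftAction_mem {k H A M : Type*} [Field k] [Ring H] [Algebra k H]
    [Ring A] [Algebra k A] [AddCommGroup M] [Module k M] [Module A M] [IsScalarTower k A M]
    {N : Submodule A M} {t : M ⊗[k] H} (ht : ∀ f : Module.Dual k H, tensorSlice M f t ∈ N)
    (u : A ⊗[k] H) (f : Module.Dual k H) :
    tensorSlice M f (tensorLeftAction k H A M u t) ∈ N := by
  induction u with
  | zero => simp
  | add x y hx hy => simp only [map_add, LinearMap.add_apply]; exact N.add_mem hx hy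
  | tmul a h =>
    have : tensorSlice M f (tensorLeftAction k H A M (a ⊗ₜ h) t) =
        a • tensorSlice M (f ∘ₗ LinearMap.mulLeft k h) t := by
      clear ht
      induction t with
      | zero => simp
      | add x y hx hy => simp only [map_add, smul_add, hx, hy]
      | tmul m g =>
        simp only [tensorLeftAction_tmul, tensorSlice_tmul, LinearMap.comp_apply,
          LinearMap.mulLeft_apply]
        exact smul_comm _ _ _
    rw [this]
    exact N.smul_mem _ (ht _)

variable {k H A : Type*} [Field k] [Ring H] [HopfAlgebra k H] [Ring A] [Algebra k A]
  [RightComoduleAlgebra k H A]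

/-- In Sweedler notation, `m₀ ⊗ m₁ S(m₂) = m₀ ⊗ ε(m₁) = m ⊗ 1`. -/
theorem RightComodule.coactMul_lTensor_antipode {M : Type*} [AddCommGroup M] [Module k M]
    [RightComodule k H M] (m : M) :
    coactMul (RightComodule.coact k H M) ((HopfAlgebra.antipode k (A := H)).lTensor M
      (RightComodule.coact k H M m)) = m ⊗ₜ 1 := by
  have h1 := LinearMap.congr_fun (RightComodule.coassoc (k := k) (H := H) (M := M)) m
  simp only [LinearMap.comp_apply, LinearEquiv.coe_coe] at h1
  have h2 : ∀ t : M ⊗[k] H, coactMul (RightComodule.coact k H M)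
      ((HopfAlgebra.antipode k (A := H)).lTensor M t) =
      (LinearMap.mul' k H ∘ₗ (HopfAlgebra.antipode k (A := H)).lTensor H).lTensor M
        (TensorProduct.assoc k M H H ((RightComodule.coact k H M).rTensor H t)) := fun t => by
    induction t with
    | zero => simp
    | add x y hx hy => simp only [map_add, hx, hy]
    | tmul m h =>
      rw [LinearMap.lTensor_tmul, coactMul_tmul, LinearMap.rTensor_tmul]
      induction RightComodule.coact k H M m with
      | zero => simp
      | add x y hx hy => simp only [map_add, TensorProduct.add_tmul, hx, hy]
      | tmul m h' => simp
  rw [h2, h1, ← LinearMap.comp_apply, ← LinearMap.lTensor_comp, LinearMap.comp_assoc,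
    HopfAlgebra.mul_antipode_lTensor_comul]
  conv_rhs => rw [← tensorSlice_counit_coact (k := k) (H := H) m]
  induction RightComodule.coact k H M m with
  | zero => simp
  | add x y hx hy => simp only [map_add, TensorProduct.add_tmul, hx, hy]
  | tmul m h =>
    rw [LinearMap.lTensor_tmul, tensorSlice_tmul, TensorProduct.smul_tmul, LinearMap.comp_apply,
      Algebra.linearMap_apply, Algebra.algebraMap_eq_smul_one]

variable {M : Type*} [AddCommGroup M] [Module k M]

theorem RightHopfModule.isGeneratingCoaction [Module Aᵐᵒᵖ M] [IsScalarTower k Aᵐᵒᵖ M]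
    [RightHopfModule k H A M] : IsGeneratingCoaction k H A (RightComodule.coact k H M) :=
  ⟨RightHopfModule.coact_smul, fun m => ⟨_, RightComodule.coactMul_lTensor_antipode m⟩⟩

theorem RightHopfModule.exists_of_mem_stableSubmodules [Module Aᵐᵒᵖ M] [IsScalarTower k Aᵐᵒᵖ M]
    [RightHopfModule k H A M] {N : Submodule Aᵐᵒᵖ M} (hN : N ∈ stableSubmodules k H Aᵐᵒᵖ M) :
    Nonempty (RightHopfModule k H A N) := by
  obtain ⟨C, hC⟩ := exists_rightComodule_of_mem_stableSubmodules hN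
  refine ⟨{ C with coact_smul := fun n a => ?_ }⟩
  apply Module.Flat.rTensor_preserves_injective_linearMap (M := H)
    (N.subtype.restrictScalars k) N.injective_subtype
  change (N.subtype.restrictScalars k).rTensor H (C.coact (MulOpposite.op a • n)) = _
  rw [tensorRightAction_map, hC, hC, ← RightHopfModule.coact_smul]
  rfl

theorem LeftHopfModule.exists_of_mem_stableSubmodules [Module A M] [IsScalarTower k A M]
    [LeftHopfModule k H A M] {N : Submodule A M} (hN : N ∈ stableSubmodules k H A M) :
    Nonempty (LeftHopfModule k H A N) := by
  obtain ⟨C, hC⟩ := exists_rightComodule_of_mem_stableSubmodules hN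
  refine ⟨{ C with coact_smul := fun a n => ?_ }⟩
  apply Module.Flat.rTensor_preserves_injective_linearMap (M := H)
    (N.subtype.restrictScalars k) N.injective_subtype
  change (N.subtype.restrictScalars k).rTensor H (C.coact (a • n)) = _
  rw [tensorLeftAction_map, hC, hC, ← LeftHopfModule.coact_smul]
  rfl

theorem RightHopfModule.isFreePowerFamily [FiniteDimensional k A] (hA : IsHSimple k H A)
    (hH : IsStablyFiniteRing H) (M : Type*) [AddCommGroup M] [Module k M] [Module Aᵐᵒᵖ M]
    [IsScalarTower k Aᵐᵒᵖ M] [RightHopfModule k H A M] :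
    IsFreePowerFamily (stableSubmodules k H Aᵐᵒᵖ M) where
  sSup_mem := sSup_mem_stableSubmodules
  inf_mem hN hN' f m hm := ⟨hN f m hm.1, hN' f m hm.2⟩
  exists_finite := exists_finite_mem_stableSubmodules fun a m N hm f => by
    rw [← MulOpposite.op_unop a, RightHopfModule.coact_smul]
    exact tensorSlice_tensorRightAction_mem hm _ f
  hasFreePower {N} hN _ := by
    obtain ⟨_⟩ := RightHopfModule.exists_of_mem_stableSubmodules hN
    have : Module.Finite k N := Module.Finite.trans Aᵐᵒᵖ N
    exact (RightHopfModule.isGeneratingCoaction (M := N)).hasFreePower hA hH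

end Comodule

/-! ### The generating coaction on the dual of a left Hopf module. -/

section Dual

variable {k A N : Type*} [Field k] [Ring A] [Algebra k A] [AddCommGroup N] [Module k N]
  [Module A N] [IsScalarTower k A N]

/-- The dual of a left `A`-module is a right `A`-module: `(ξ a)(n) = ξ(a n)`. -/
noncomputable instance dualRightModule : Module Aᵐᵒᵖ (Module.Dual k N) where
  smul a ξ := ξ ∘ₗ Algebra.lsmul k k N a.unop
  one_smul ξ := LinearMap.ext fun n => congrArg ξ (one_smul A n)
  mul_smul a b ξ := LinearMap.ext fun n => congrArg ξ (mul_smul b.unop a.unop n)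
  smul_zero a := rfl
  smul_add a ξ η := rfl
  add_smul a b ξ := LinearMap.ext fun n => by
    change ξ ((a.unop + b.unop) • n) = ξ (a.unop • n) + ξ (b.unop • n)
    rw [add_smul, map_add]
  zero_smul ξ := LinearMap.ext fun n => by
    change ξ ((0 : A) • n) = 0
    rw [zero_smul, map_zero]

theorem dualRightModule_smul_apply (a : Aᵐᵒᵖ) (ξ : Module.Dual k N) (n : N) :
    (a • ξ) n = ξ (a.unop • n) := rfl

instance : IsScalarTower k Aᵐᵒᵖ (Module.Dual k N) where
  smul_assoc c a ξ := LinearMap.ext fun n => by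
    change ξ ((c • a.unop) • n) = c • ξ (a.unop • n)
    rw [smul_assoc, map_smul]

variable {H : Type*} [Ring H] [HopfAlgebra k H] [RightComoduleAlgebra k H A]

/-- The coaction on `N^*` is given by `ξ₀(n) ξ₁ = ξ(n₀) S(n₁)`. The antipode need not be bijective,
only anti-multiplicative. -/
theorem LeftHopfModule.exists_isGeneratingCoaction_dual [LeftHopfModule k H A N]
    [Module.Finite k N] :
    ∃ ρ : Module.Dual k N →ₗ[k] Module.Dual k N ⊗[k] H, IsGeneratingCoaction k H A ρ := by
  let S := HopfAlgebra.antipode k (A := H)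
  let E : Module.Dual k N ⊗[k] H ≃ₗ[k] (N →ₗ[k] H) := dualTensorHomEquiv k N H
  have hE : ∀ (η : Module.Dual k N) (g : H) (n : N), E (η ⊗ₜ g) n = η n • g := fun η g n => by
    simp [E]
  let sl : Module.Dual k N → N ⊗[k] H →ₗ[k] H := fun ξ =>
    (TensorProduct.lid k H).toLinearMap ∘ₗ ξ.rTensor H
  let c : Module.Dual k N →ₗ[k] (N →ₗ[k] H) :=
    { toFun := fun ξ => S ∘ₗ sl ξ ∘ₗ RightComodule.coact k H N
      map_add' := fun ξ η => by
        ext n; simp [sl, LinearMap.rTensor_add]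
      map_smul' := fun r ξ => by
        ext n; simp [sl, LinearMap.rTensor_smul] }
  have hc : ∀ ξ n, c ξ n = S (sl ξ (RightComodule.coact k H N n)) := fun _ _ => rfl
  let ρ : Module.Dual k N →ₗ[k] Module.Dual k N ⊗[k] H := E.symm.toLinearMap ∘ₗ c
  have hρ : ∀ ξ, E (ρ ξ) = c ξ := fun ξ => E.apply_symm_apply _
  refine ⟨ρ, ⟨fun ξ a => ?_, fun ξ => ?_⟩⟩
  · apply E.injective
    rw [hρ]
    ext n
    -- Compatibility is the computation `ξ(a₀ n₀) S(a₁ n₁) a₂ = ξ(a₀ n₀) S(n₁) S(a₁) a₂ = ξ(a n₀)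
    -- S(n₁)`.
    let act : A →ₗ[k] N := (LinearMap.toSpanSingleton A N n).restrictScalars k
    have h1 : ∀ t u, E (tensorRightAction k H A (Module.Dual k N) t u) n =
        LinearMap.mul' k H ((E t ∘ₗ act).rTensor H u) := fun t u => by
      induction t with
      | zero => simp
      | add x y hx hy =>
        simp only [map_add, LinearMap.add_apply, LinearMap.add_comp, LinearMap.rTensor_add, hx, hy]
      | tmul η g =>
        induction u with
        | zero => simp
        | add x y hx hy => simp only [map_add, LinearMap.add_apply, hx, hy]
        | tmul b h =>
          rw [tensorRightAction_tmul, hE, LinearMap.rTensor_tmul, LinearMap.comp_apply, hE]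
          simp [act, dualRightModule_smul_apply]
    have h2 : ∀ b t (h : H), sl ξ (tensorLeftAction k H A N (b ⊗ₜ h) t) =
        h * sl (MulOpposite.op b • ξ) t := fun b t h => by
      induction t with
      | zero => simp
      | add x y hx hy => simp only [map_add, mul_add, hx, hy]
      | tmul m g => simp [sl, tensorLeftAction_tmul, dualRightModule_smul_apply]
    let G : A ⊗[k] H →ₗ[k] H :=
      S ∘ₗ sl ξ ∘ₗ (tensorLeftAction k H A N).flip (RightComodule.coact k H N n)
    have hG : c ξ ∘ₗ act = G ∘ₗ RightComodule.coact k H A := by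
      ext b
      simp only [LinearMap.comp_apply, hc, G, act, LinearMap.flip_apply, ← LeftHopfModule.coact_smul]
      rfl
    have h3 : ∀ (b : A) (z : H ⊗[k] H), LinearMap.mul' k H (G.rTensor H
        ((TensorProduct.assoc k A H H).symm (b ⊗ₜ z))) =
        c (MulOpposite.op b • ξ) n * LinearMap.mul' k H (S.rTensor H z) := fun b z => by
      induction z with
      | zero => simp
      | add x y hx hy => simp only [TensorProduct.tmul_add, map_add, mul_add, hx, hy]
      | tmul x y =>
        simp [G, h2, hc, S, HopfAlgebra.antipode_mul_antidistrib, mul_assoc]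
    have h4 : ∀ u : A ⊗[k] H, LinearMap.mul' k H (G.rTensor H
        ((TensorProduct.assoc k A H H).symm ((Coalgebra.comul (R := k)).lTensor A u))) =
        c (MulOpposite.op (tensorSlice A Coalgebra.counit u) • ξ) n := fun u => by
      induction u with
      | zero => simp
      | add x y hx hy =>
        simp only [map_add, MulOpposite.op_add, add_smul, LinearMap.add_apply, hx, hy]
      | tmul b h =>
        rw [LinearMap.lTensor_tmul, h3, HopfAlgebra.mul_antipode_rTensor_comul_apply,
          tensorSlice_tmul, MulOpposite.op_smul, smul_assoc,
          c.map_smul (Coalgebra.counit (R := k) h), LinearMap.smul_apply, Algebra.algebraMap_eq_smul_one, mul_smul_comm, mul_one]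
    have h5 := LinearMap.congr_fun (RightComodule.coassoc (k := k) (H := H) (M := A)) a
    simp only [LinearMap.comp_apply, LinearEquiv.coe_coe] at h5
    rw [← LinearEquiv.eq_symm_apply] at h5
    rw [h1, hρ, hG, LinearMap.rTensor_comp, LinearMap.comp_apply, h5, h4, tensorSlice_counit_coact]
  -- Evaluated at `n`, the identity reads `ξ₀(n₀) S(n₁) S(ξ₁) = S(ξ₁ ξ₀(n₀) n₁) = S(ξ(n₀) S(n₁) n₂)
  -- = ξ(n) 1`.
  · refine ⟨S.lTensor _ (ρ ξ), ?_⟩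
    apply E.injective
    ext n
    have h1 : ∀ (t : Module.Dual k N ⊗[k] H) (h : H),
        E (tensorMulRight k _ h t) n = E t n * h := fun t h => by
      induction t with
      | zero => simp
      | add x y hx hy => simp only [map_add, LinearMap.add_apply, add_mul, hx, hy]
      | tmul η g => rw [LinearMap.lTensor_tmul, hE, hE]; simp
    have h2 : ∀ (η : Module.Dual k N) (g : H) (t : N ⊗[k] H),
        LinearMap.mul' k H ((E (η ⊗ₜ g)).rTensor H t) = g * sl η t := fun η g t => by
      induction t with
      | zero => simp
      | add x y hx hy => simp only [map_add, mul_add, hx, hy]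
      | tmul m h => rw [LinearMap.rTensor_tmul, hE]; simp [sl]
    have h3 : ∀ s, E (coactMul ρ (S.lTensor _ s)) n =
        S (LinearMap.mul' k H ((E s).rTensor H (RightComodule.coact k H N n))) := fun s => by
      induction s with
      | zero => simp
      | add x y hx hy => simp only [map_add, LinearMap.add_apply, LinearMap.rTensor_add, hx, hy]
      | tmul η g =>
        rw [h2, LinearMap.lTensor_tmul, coactMul_tmul, h1, hρ, hc]
        exact (HopfAlgebra.antipode_mul_antidistrib _ _).symm
    have h4 : ∀ (m : N) (z : H ⊗[k] H), LinearMap.mul' k H ((S ∘ₗ sl ξ).rTensor H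
        ((TensorProduct.assoc k N H H).symm (m ⊗ₜ z))) =
        ξ m • LinearMap.mul' k H (S.rTensor H z) := fun m z => by
      induction z with
      | zero => simp
      | add x y hx hy => simp only [TensorProduct.tmul_add, map_add, smul_add, hx, hy]
      | tmul x y => simp [sl]
    have h5 : ∀ u : N ⊗[k] H, LinearMap.mul' k H ((S ∘ₗ sl ξ).rTensor H
        ((TensorProduct.assoc k N H H).symm ((Coalgebra.comul (R := k)).lTensor N u))) =
        ξ (tensorSlice N Coalgebra.counit u) • 1 := fun u => by
      induction u with
      | zero => simp
      | add x y hx hy => simp only [map_add, add_smul, hx, hy]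
      | tmul m h =>
        rw [LinearMap.lTensor_tmul, h4, HopfAlgebra.mul_antipode_rTensor_comul_apply,
          tensorSlice_tmul, map_smul, Algebra.algebraMap_eq_smul_one, smul_smul, smul_eq_mul,
          mul_comm]
    have h6 := LinearMap.congr_fun (RightComodule.coassoc (k := k) (H := H) (M := N)) n
    simp only [LinearMap.comp_apply, LinearEquiv.coe_coe] at h6
    rw [← LinearEquiv.eq_symm_apply] at h6
    have hcξ : c ξ = (S ∘ₗ sl ξ) ∘ₗ RightComodule.coact k H N := rfl
    rw [h3, hρ, hcξ, LinearMap.rTensor_comp, LinearMap.comp_apply, h6, h5,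
      tensorSlice_counit_coact, hE, map_smul]
    exact congrArg _ HopfAlgebra.antipode_one

end Dual

/-! ### The Frobenius property and the transfer to left modules. -/

section Frobenius

variable {k H A : Type*} [Field k] [Ring H] [HopfAlgebra k H] [Ring A] [Algebra k A]
  [RightComoduleAlgebra k H A] [FiniteDimensional k A]

theorem RightComoduleAlgebra.tensorLeftAction_eq_mul {k H A : Type*} [Field k] [Ring H]
    [Algebra k H] [Ring A] [Algebra k A] (t u : A ⊗[k] H) : tensorLeftAction k H A A t u = t * u := by
  induction t with
  | zero => simp
  | add x y hx hy => simp only [map_add, LinearMap.add_apply, add_mul, hx, hy]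
  | tmul a h =>
    induction u with
    | zero => simp
    | add x y hx hy => simp only [map_add, mul_add, hx, hy]
    | tmul b g => rw [tensorLeftAction_tmul, Algebra.TensorProduct.tmul_mul_tmul, smul_eq_mul]

/-- A comodule algebra is a Hopf module over itself. -/
noncomputable instance : LeftHopfModule k H A A where
  coact_smul a b := by
    rw [smul_eq_mul, RightComoduleAlgebra.coact_mul,
      RightComoduleAlgebra.tensorLeftAction_eq_mul]

/-- A finite-dimensional `H`-simple comodule algebra over a weakly finite Hopf algebra has a
functional which generates the dual as a right module. -/
theorem IsHSimple.exists_functional (hA : IsHSimple k H A) (hH : IsStablyFiniteRing H) :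
    ∃ lam : A →ₗ[k] k, Function.Bijective fun x : A => lam ∘ₗ LinearMap.mulLeft k x := by
  have := hA.1
  obtain ⟨ρ, hρ⟩ := LeftHopfModule.exists_isGeneratingCoaction_dual (k := k) (H := H) (A := A)
    (N := A)
  have hdim : Module.finrank k (Module.Dual k A) = Module.finrank k Aᵐᵒᵖ :=
    (Subspace.dual_finrank_eq (K := k) (V := A)).trans
      (MulOpposite.opLinearEquiv k (M := A)).finrank_eq
  obtain ⟨l, n, hl, h1, h2⟩ := (hρ.hasFreePower hA hH).exists_finrank_eq k
  -- Since `dim A^* = dim A`, the free power of `A^*` has as many factors on both sides, so every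
  -- rank of `A^*` is `1` and one generator suffices.
  have hln : l = n := by
    rw [hdim] at h1
    exact Nat.eq_of_mul_eq_mul_right Module.finrank_pos h1
  subst hln
  obtain ⟨f, hf, -⟩ := exists_linearMap_surjective_of_rank_le (R := Aᵐᵒᵖ)
    (M := Module.Dual k A) k (ι := Unit) fun P hP => by
      have : FiniteDimensional k (Aᵐᵒᵖ ⧸ P.asIdeal) := Module.Finite.of_surjective
        (Ideal.Quotient.mkₐ k P.asIdeal).toLinearMap Ideal.Quotient.mk_surjective
      rw [rank_finsupp, ← Module.finrank_eq_rank,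
        ← Module.finrank_eq_rank k (Aᵐᵒᵖ ⧸ P.asIdeal), Nat.eq_of_mul_eq_mul_left hl (h2 P)]
      simp [-Module.finrank_eq_rank]
  let lam : Module.Dual k A := f (Finsupp.single () 1)
  let g : A →ₗ[k] Module.Dual k A := (LinearMap.mul k A).compr₂ lam
  have hg : ∀ x, g x = MulOpposite.op x • lam := fun x => rfl
  have hgsurj : Function.Surjective g := fun ξ => by
    obtain ⟨w, rfl⟩ := hf ξ
    refine ⟨(w ()).unop, ?_⟩
    rw [hg, MulOpposite.op_unop, ← map_smul, Finsupp.smul_single, smul_eq_mul, mul_one]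
    congr 1
    ext
    simp
  exact ⟨lam, (LinearMap.injective_iff_surjective_of_finrank_eq_finrank
    (Subspace.dual_finrank_eq (K := k) (V := A)).symm).2 hgsurj, hgsurj⟩

theorem isFrobeniusAlgebra_of_bijective {k A : Type*} [Field k] [Ring A] [Algebra k A]
    [FiniteDimensional k A] {lam : A →ₗ[k] k}
    (hlam : Function.Bijective fun x : A => lam ∘ₗ LinearMap.mulLeft k x) :
    IsFrobeniusAlgebra k A := by
  refine ⟨inferInstance, LinearEquiv.ofBijective ((LinearMap.mul k A).compr₂ lam) hlam,
    fun x a b => ?_⟩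
  exact congrArg lam (mul_assoc x a b)

theorem eq_zero_of_functional_mul_left {k A : Type*} [Field k] [Ring A] [Algebra k A]
    {lam : A →ₗ[k] k}
    (hlam : Function.Bijective fun x : A => lam ∘ₗ LinearMap.mulLeft k x) (x : A)
    (h : ∀ y, lam (y * x) = 0) : x = 0 := by
  rw [← Module.forall_dual_apply_eq_zero_iff k]
  intro ξ
  obtain ⟨y, rfl⟩ := hlam.2 ξ
  exact h y

theorem eq_zero_of_functional_mul_right {k A : Type*} [Field k] [Ring A] [Algebra k A]
    {lam : A →ₗ[k] k}
    (hlam : Function.Bijective fun x : A => lam ∘ₗ LinearMap.mulLeft k x) (x : A)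
    (h : ∀ y, lam (x * y) = 0) : x = 0 :=
  hlam.1 (LinearMap.ext fun y => by simp [h])

/-- Dualize `(N^*)^l ≅ A^n`, identifying `A` with `A^*` through `lam` and `N` with `N^**`. -/
theorem HasFreePower.of_dual {k A N : Type*} [Field k] [Ring A] [Algebra k A]
    [FiniteDimensional k A] [AddCommGroup N] [Module k N] [Module A N] [IsScalarTower k A N]
    [Module.Finite k N] {lam : A →ₗ[k] k}
    (hlam : Function.Bijective fun x : A => lam ∘ₗ LinearMap.mulLeft k x)
    (h : HasFreePower Aᵐᵒᵖ (Module.Dual k N)) : HasFreePower A N := by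
  obtain ⟨l, n, hl, ⟨T⟩⟩ := h
  have hT : l * Module.finrank k N = n * Module.finrank k A := by
    have := (T.restrictScalars k).finrank_eq
    simpa [Module.finrank_pi_fintype, Subspace.dual_finrank_eq,
      ← (MulOpposite.opLinearEquiv k (M := A)).finrank_eq] using this
  -- `F` is the transpose of `T`, with `y ∈ A^n` regarded as the functional `z ↦ ∑ j, lam (z j * y
  -- j)`.
  let F : (Fin n → A) → Fin l → Module.Dual k (Module.Dual k N) := fun y i =>
    ∑ j, (lam ∘ₗ LinearMap.mulRight k (y j) ∘ₗ
      (MulOpposite.opLinearEquiv k (M := A)).symm.toLinearMap) ∘ₗ LinearMap.proj j ∘ₗ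
        (T.toLinearMap.restrictScalars k) ∘ₗ LinearMap.single k (fun _ => Module.Dual k N) i
  have hF : ∀ y i ξ, F y i ξ = ∑ j, lam ((T (Pi.single i ξ) j).unop * y j) := fun y i ξ => by
    simp [F]
  let ev := Module.evalEquiv k N
  let Ψ : (Fin n → A) → Fin l → N := fun y i => ev.symm (F y i)
  have hΨ : ∀ y i ξ, ξ (Ψ y i) = ∑ j, lam ((T (Pi.single i ξ) j).unop * y j) := fun y i ξ => by
    rw [← hF, ← ev.apply_symm_apply (F y i)]
    rfl
  have hext : ∀ a b : N, (∀ ξ : Module.Dual k N, ξ a = ξ b) → a = b := fun a b h =>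
    ev.injective (LinearMap.ext h)
  let Φ : (Fin n → A) →ₗ[A] Fin l → N :=
    { toFun := Ψ
      map_add' := fun x y => funext fun i => hext _ _ fun ξ => by
        rw [Pi.add_apply, map_add, hΨ, hΨ, hΨ, ← Finset.sum_add_distrib]
        simp only [Pi.add_apply, mul_add, map_add]
      map_smul' := fun a y => funext fun i => hext _ _ fun ξ => by
        have h1 : ξ ((a • Ψ y) i) = (MulOpposite.op a • ξ) (Ψ y i) := rfl
        rw [RingHom.id_apply, h1, hΨ, hΨ]
        refine Finset.sum_congr rfl fun j _ => ?_
        rw [Pi.single_smul, map_smul, Pi.smul_apply, Pi.smul_apply, smul_eq_mul, smul_eq_mul,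
          MulOpposite.unop_mul, MulOpposite.unop_op, mul_assoc] }
  have hinj : Function.Injective Φ := by
    rw [injective_iff_map_eq_zero]
    intro y hy
    have h1 : ∀ z : Fin l → Module.Dual k N, ∑ j, lam ((T z j).unop * y j) = 0 := fun z => by
      rw [← Finset.univ_sum_single z]
      simp only [map_sum, Finset.sum_apply, Finset.unop_sum, Finset.sum_mul]
      rw [Finset.sum_comm]
      refine Finset.sum_eq_zero fun i _ => ?_
      rw [← hΨ, show Ψ y i = 0 from congrFun hy i, map_zero]
    funext j
    refine eq_zero_of_functional_mul_left hlam _ fun a => ?_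
    obtain ⟨z, hz⟩ := T.surjective (Pi.single j (MulOpposite.op a))
    have h2 := h1 z
    rw [hz, Finset.sum_eq_single j (fun i _ hij => by simp [hij]) (by simp)] at h2
    simpa using h2
  have hbij : Function.Bijective Φ := by
    refine ⟨hinj, (LinearMap.injective_iff_surjective_of_finrank_eq_finrank
      (f := Φ.restrictScalars k) ?_).1 hinj⟩
    simp [Module.finrank_pi_fintype, hT]
  exact ⟨l, n, hl, ⟨(LinearEquiv.ofBijective Φ hbij).symm⟩⟩

theorem LeftHopfModule.isFreePowerFamily (hA : IsHSimple k H A)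
    (hH : IsStablyFiniteRing H) (M : Type*) [AddCommGroup M] [Module k M] [Module A M]
    [IsScalarTower k A M] [LeftHopfModule k H A M] :
    IsFreePowerFamily (stableSubmodules k H A M) where
  sSup_mem := sSup_mem_stableSubmodules
  inf_mem hN hN' f m hm := ⟨hN f m hm.1, hN' f m hm.2⟩
  exists_finite := exists_finite_mem_stableSubmodules fun a m N hm f => by
    rw [LeftHopfModule.coact_smul]
    exact tensorSlice_tensorLeftAction_mem hm _ f
  hasFreePower {N} hN _ := by
    obtain ⟨_⟩ := LeftHopfModule.exists_of_mem_stableSubmodules hN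
    have : Module.Finite k N := Module.Finite.trans A N
    obtain ⟨lam, hlam⟩ := hA.exists_functional hH
    obtain ⟨ρ, hρ⟩ := LeftHopfModule.exists_isGeneratingCoaction_dual (k := k) (H := H) (A := A)
      (N := N)
    exact HasFreePower.of_dual hlam (hρ.hasFreePower hA hH)

end Frobenius

theorem theorem4p2 {k H A : Type*} [Field k] [Ring H] [HopfAlgebra k H]
    [Ring A] [Algebra k A] [FiniteDimensional k A] [RightComoduleAlgebra k H A]
    (hA : IsHSimple k H A) (hH : IsStablyFiniteRing H) :
    IsFrobeniusAlgebra k A ∧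
    (∀ (M : Type*) [AddCommGroup M] [Module k M] [Module Aᵐᵒᵖ M] [IsScalarTower k Aᵐᵒᵖ M]
      [RightHopfModule k H A M],
      Module.Projective Aᵐᵒᵖ M ∧
      (Module.Free Aᵐᵒᵖ M ↔ ∃ Q : TwoSidedIdeal A, IsCoatom Q ∧ RightReductionFree M Q)) ∧
    (∀ (M : Type*) [AddCommGroup M] [Module k M] [Module A M] [IsScalarTower k A M]
      [LeftHopfModule k H A M],
      Module.Projective A M ∧
      (Module.Free A M ↔ ∃ Q : TwoSidedIdeal A, IsCoatom Q ∧ LeftReductionFree M Q)) := by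
  have := hA.1
  obtain ⟨lam, hlam⟩ := hA.exists_functional hH
  refine ⟨isFrobeniusAlgebra_of_bijective hlam, fun M _ _ _ _ _ => ?_, fun M _ _ _ _ _ =>
    (LeftHopfModule.isFreePowerFamily hA hH M).projective_and_free_iff
      (eq_zero_of_functional_mul_left hlam)⟩
  -- Over `Aᵐᵒᵖ` the products are reversed, so the nondegeneracy needed is that of `lam` on the
  -- other side.
  obtain ⟨hproj, hfree⟩ := (RightHopfModule.isFreePowerFamily hA hH M).projective_and_free_iff
    (lam := lam ∘ₗ (MulOpposite.opLinearEquiv k (M := A)).symm.toLinearMap) fun x h =>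
      MulOpposite.unop_injective (eq_zero_of_functional_mul_right hlam x.unop fun y =>
        h (MulOpposite.op y))
  refine ⟨hproj, hfree.trans ⟨fun ⟨P, hP, h⟩ => ⟨P.unop, ?_, h⟩, fun ⟨Q, hQ, h⟩ =>
    ⟨Q.op, ?_, h⟩⟩⟩
  · exact (OrderIso.isCoatom_iff TwoSidedIdeal.opOrderIso P.unop).1 hP
  · exact (OrderIso.isCoatom_iff TwoSidedIdeal.opOrderIso Q).2 hQ
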